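/- **Setting.** An abstract state space is a real ordered Banach space $X$ with closed, generating positive cone $X_+$ on which the norm is additive: $\|u+v\|=\|u\|+\|v\|$ for $u,v\in X_+$. Let $\Psi:X\to\mathbb R$ be the linear functional with $\langle\Psi,u\rangle=\|u\|$ for $u\in X_+$. A $C_0$-semigroup $(T(t))_{t\ge 0}$ of bounded operators on $X$ is called substochastic if $T(t)u\in X_+$ and $\|T(t)u\|\le\|u\|$ for all $t\ge0$, $u\in X_+$. Let $A,B$ be linear operators in $X$ with $D(A)\subseteq D(B)$ such that $A$ generates a substochastic $C_0$-semigroup, $Bu\ge 0$ for all $u\in D(A)\cap X_+$, and $\langle\Psi,Au+Bu\rangle\le 0$ for all $u\in D(A)\cap X_+$. The Kato semigroup of $A,B$ is the substochastic $C_0$-semigroup $(V(t))_{t\ge0}$ whose generator $G$ extends $A+B$ and satisfies, for all $\lambda>0$ and $u\in X$, $$R(\lambda,G)u=\sum_{k=0}^\infty R(\lambda,A)(BR(\lambda,A))^ku ,$$ where $R(\lambda,T)=(\lambda-T)^{-1}$. For $u\in D(G)$ put $a_0(u)=-\langle\Psi,Gu\rangle$, and define $\bar a:D(G)\to\mathbb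 R$ by $$\bar a(R(\lambda,G)u)=-\sum_{k=0}^\infty\langle\Psi,(A+B)R(\lambda,A)(BR(\lambda,A))^ku\rangle\qquad(u\in X),$$ where $\lambda>0$ is any fixed number ($\bar a$ does not depend on its choice; the assertions below hold with each $\lambda>0$). The semigroup $V$ is called honest if $$\|V(t)u\|-\|u\|=-\bar a\Big(\int_0^tV(s)u\,ds\Big)\qquad\text{for all }t\ge0,\ u\in X_+,$$ and dishonest otherwise. **Theorem.** Let $X$ be an abstract state space and let $A,B$ be as above. Then the Kato semigroup $V$ of $A,B$ exists and is unique, and, with $G$ its generator: (i) If $V$ is honest, then $V$ is the unique substochastic $C_0$-semigroup whose generator is an extension of $A+B$. (ii) If $V$ is dishonest, then there are infinitely many substochastic $C_0$-semigroups whose generators are extensions of $A+B$. More precisely, for every $u_0\in X_+\setminus\{0\}$ with $\|u_0\|\le1$, the operator $$\tilde Gu=Gu+(a_0-\bar a)(u)\,u_0,\qquad D(\tilde G)=D(G),$$ is an extension of $A+B$ and generates a substochastic $C_0$-semigroup, and infinitely many different semigroups arise in this way. -/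

import Mathlib

open Filter Topology
open scoped NNReal

namespace KatoHonesty

/-- An abstract state space: a real ordered Banach space (its positive cone `{u | 0 ≤ u}` is
closed) whose positive cone is generating and on whose positive cone the norm is additive. -/
class AbstractStateSpace (X : Type*) [NormedAddCommGroup X] [NormedSpace ℝ X] [PartialOrder X] :
    Prop extends CompleteSpace X, IsOrderedAddMonoid X, PosSMulMono ℝ X,
      OrderClosedTopology X where
  generating : ∀ x : X, ∃ u v : X, 0 ≤ u ∧ 0 ≤ v ∧ x = u - v
  norm_add_of_nonneg : ∀ u v : X, 0 ≤ u → 0 ≤ v → ‖u + v‖ = ‖u‖ + ‖v‖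

section Psi

variable {X : Type*} [NormedAddCommGroup X] [NormedSpace ℝ X] [PartialOrder X]
  [AbstractStateSpace X]

theorem norm_sub_norm_eq {u v u' v' : X} (hu : 0 ≤ u) (hv : 0 ≤ v) (hu' : 0 ≤ u') (hv' : 0 ≤ v')
    (h : u - v = u' - v') : ‖u‖ - ‖v‖ = ‖u'‖ - ‖v'‖ := by
  have h1 : u + v' = u' + v := by
    rw [sub_eq_sub_iff_add_eq_add] at h
    exact h
  have h2 := AbstractStateSpace.norm_add_of_nonneg u v' hu hv'
  have h3 := AbstractStateSpace.norm_add_of_nonneg u' v hu' hv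
  rw [h1] at h2
  linarith

theorem exists_psi : ∃ f : X →ₗ[ℝ] ℝ, ∀ u : X, 0 ≤ u → f u = ‖u‖ := by
  choose p q hp hq hpq using AbstractStateSpace.generating (X := X)
  have key : ∀ x u v : X, 0 ≤ u → 0 ≤ v → x = u - v → ‖p x‖ - ‖q x‖ = ‖u‖ - ‖v‖ := by
    intro x u v hu hv hx
    exact norm_sub_norm_eq (hp x) (hq x) hu hv (by rw [← hpq x, ← hx])
  have hpos : ∀ (c : ℝ) (x : X), 0 ≤ c → ‖p (c • x)‖ - ‖q (c • x)‖ = c * (‖p x‖ - ‖q x‖) := by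
    intro c x hc
    rw [key (c • x) (c • p x) (c • q x) (smul_nonneg hc (hp x)) (smul_nonneg hc (hq x))
      (by rw [← smul_sub, ← hpq x]), norm_smul, norm_smul, Real.norm_of_nonneg hc]
    ring
  have hneg : ∀ x : X, ‖p (-x)‖ - ‖q (-x)‖ = -(‖p x‖ - ‖q x‖) := by
    intro x
    rw [key (-x) (q x) (p x) (hq x) (hp x) (by nth_rewrite 1 [hpq x]; abel)]
    ring
  refine ⟨{ toFun := fun x => ‖p x‖ - ‖q x‖, map_add' := ?_, map_smul' := ?_ }, ?_⟩
  · intro x y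
    rw [key (x + y) (p x + p y) (q x + q y) (add_nonneg (hp x) (hp y)) (add_nonneg (hq x) (hq y))
      (by nth_rewrite 1 [hpq x, hpq y]; abel),
      AbstractStateSpace.norm_add_of_nonneg _ _ (hp x) (hp y),
      AbstractStateSpace.norm_add_of_nonneg _ _ (hq x) (hq y)]
    ring
  · intro c x
    rcases le_total 0 c with hc | hc
    · exact hpos c x hc
    · have h1 := hpos (-c) x (by linarith)
      have h2 := hneg ((-c) • x)
      rw [neg_smul, neg_neg] at h2
      rw [neg_smul] at h1
      simp only [RingHom.id_apply, smul_eq_mul]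
      rw [h2, h1]
      ring
  · intro u hu
    simpa using key u u 0 hu le_rfl (by simp)

variable (X) in
/-- The linear functional `Ψ` that extends the norm from the positive cone to `X`. -/
noncomputable def psi : X →ₗ[ℝ] ℝ := Classical.choose (exists_psi (X := X))

theorem psi_of_nonneg {u : X} (hu : 0 ≤ u) : psi X u = ‖u‖ :=
  Classical.choose_spec (exists_psi (X := X)) u hu

end Psi

section Operators

variable {X : Type*} [NormedAddCommGroup X] [NormedSpace ℝ X]

/-- The value `T x` of an unbounded operator `T`, with value `0` for `x` outside `D(T)`. -/
noncomputable def val (T : X →ₗ.[ℝ] X) (x : X) : X :=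
  open Classical in if h : x ∈ T.domain then T ⟨x, h⟩ else 0

/-- `R` is the (bounded, everywhere defined) inverse of `lam - T : D(T) → X`. -/
def IsResolvent (T : X →ₗ.[ℝ] X) (lam : ℝ) (R : X →L[ℝ] X) : Prop :=
  (∀ u : X, ∃ h : R u ∈ T.domain, lam • R u - T ⟨R u, h⟩ = u) ∧
    ∀ x : T.domain, R (lam • (x : X) - T x) = x

/-- The resolvent `R(lam, T) = (lam - T)⁻¹` (and `0` if `lam` is not in the resolvent set). -/
noncomputable def resolventOp (T : X →ₗ.[ℝ] X) (lam : ℝ) : X →L[ℝ] X :=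
  open Classical in if h : ∃ R, IsResolvent T lam R then Classical.choose h else 0

theorem IsResolvent.unique {T : X →ₗ.[ℝ] X} {lam : ℝ} {R S : X →L[ℝ] X}
    (hR : IsResolvent T lam R) (hS : IsResolvent T lam S) : R = S := by
  ext u
  obtain ⟨h, hu⟩ := hR.1 u
  have := hS.2 ⟨R u, h⟩
  rw [hu] at this
  exact this.symm

theorem IsResolvent.resolventOp_eq {T : X →ₗ.[ℝ] X} {lam : ℝ} {R : X →L[ℝ] X}
    (hR : IsResolvent T lam R) : resolventOp T lam = R := by
  have h : ∃ R, IsResolvent T lam R := ⟨R, hR⟩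
  rw [resolventOp, dif_pos h]
  exact (Classical.choose_spec h).unique hR

end Operators

/-- A `C₀`-semigroup (strongly continuous one-parameter semigroup) of bounded operators. -/
@[ext]
structure C0Semigroup (X : Type*) [NormedAddCommGroup X] [NormedSpace ℝ X] where
  toFun : ℝ≥0 → X →L[ℝ] X
  map_zero : toFun 0 = ContinuousLinearMap.id ℝ X
  map_add : ∀ s t : ℝ≥0, toFun (s + t) = (toFun s).comp (toFun t)
  tendsto_zero : ∀ x : X, Tendsto (fun t => toFun t x) (𝓝 0) (𝓝 x)

namespace C0Semigroup

variable {X : Type*} [NormedAddCommGroup X] [NormedSpace ℝ X]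

/-- The graph of the generator: all `(x, y)` with `y = lim_{t ↓ 0} t⁻¹ (T(t) x - x)`. -/
def generatorGraph (T : C0Semigroup X) : Submodule ℝ (X × X) where
  carrier := {p | Tendsto (fun t : ℝ≥0 => (t : ℝ)⁻¹ • (T.toFun t p.1 - p.1)) (𝓝[>] 0) (𝓝 p.2)}
  add_mem' := by
    intro p q hp hq
    refine (Tendsto.add hp hq).congr fun t => ?_
    simp only [Prod.fst_add, _root_.map_add, ← smul_add]
    congr 1
    abel
  zero_mem' := by simp
  smul_mem' := by
    intro c p hp
    refine (Tendsto.const_smul hp c).congr fun t => ?_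
    simp only [Prod.smul_fst, map_smul, ← smul_sub]
    rw [smul_comm]

/-- The generator of a `C₀`-semigroup, with its maximal domain. -/
noncomputable def generator (T : C0Semigroup X) : X →ₗ.[ℝ] X := T.generatorGraph.toLinearPMap

theorem mem_graph_generator (T : C0Semigroup X) (p : X × X) :
    p ∈ T.generator.graph ↔
      Tendsto (fun t : ℝ≥0 => (t : ℝ)⁻¹ • (T.toFun t p.1 - p.1)) (𝓝[>] 0) (𝓝 p.2) := by
  have h : T.generator.graph = T.generatorGraph := by
    apply Submodule.toLinearPMap_graph_eq
    rintro ⟨x, y⟩ hxy (rfl : x = 0)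
    have hxy' : Tendsto (fun t : ℝ≥0 => (t : ℝ)⁻¹ • (T.toFun t (0 : X) - 0)) (𝓝[>] 0) (𝓝 y) := hxy
    simp only [_root_.map_zero, sub_zero, smul_zero] at hxy'
    exact tendsto_nhds_unique hxy' tendsto_const_nhds
  rw [h]
  rfl

/-- All `T(t)` are positive and contractive on the positive cone. -/
def IsSubstochastic [PartialOrder X] (T : C0Semigroup X) : Prop :=
  ∀ (t : ℝ≥0) (u : X), 0 ≤ u → 0 ≤ T.toFun t u ∧ ‖T.toFun t u‖ ≤ ‖u‖

end C0Semigroup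

section Kato

variable {X : Type*} [NormedAddCommGroup X] [NormedSpace ℝ X] [PartialOrder X]
  [AbstractStateSpace X]

/-- The hypotheses on `A` and `B` in Kato's perturbation theorem. -/
structure KatoConditions (A B : X →ₗ.[ℝ] X) : Prop where
  domain_le : A.domain ≤ B.domain
  generates : ∃ U : C0Semigroup X, U.IsSubstochastic ∧ U.generator = A
  nonneg : ∀ u : X, u ∈ A.domain → 0 ≤ u → 0 ≤ val B u
  psi_le : ∀ u : X, u ∈ A.domain → 0 ≤ u → psi X (val A u + val B u) ≤ 0

/-- The `k`-th term `R(lam, A) (B R(lam, A))^k u` of Kato's resolvent series. -/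
noncomputable def katoTerm (A B : X →ₗ.[ℝ] X) (lam : ℝ) (k : ℕ) (u : X) : X :=
  resolventOp A lam ((fun w => val B (resolventOp A lam w))^[k] u)

/-- `V` is the Kato (perturbed) semigroup of `A`, `B`: a substochastic `C₀`-semigroup whose
generator `G` extends `A + B` and satisfies `R(lam, G) u = ∑ₖ R(lam, A) (B R(lam, A))^k u`. -/
structure IsKatoSemigroup (A B : X →ₗ.[ℝ] X) (V : C0Semigroup X) : Prop where
  substochastic : V.IsSubstochastic
  extends_add : A + B ≤ V.generator
  resolvent_eq : ∀ lam : ℝ, 0 < lam → ∀ u : X,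
    HasSum (fun k : ℕ => katoTerm A B lam k u) (resolventOp V.generator lam u)

/-- The functional `a₀(u) = -⟨Ψ, G u⟩` on `D(G)`. -/
noncomputable def aZero (G : X →ₗ.[ℝ] X) (u : X) : ℝ := -psi X (val G u)

/-- The functional `ā_lam` on `D(G)`, determined by
`ā_lam (R(lam, G) u) = ∑ₖ a(R(lam, A) (B R(lam, A))^k u)` with `a(x) = -⟨Ψ, A x + B x⟩`;
thus at `x ∈ D(G)` one takes `u = lam x - G x`. -/
noncomputable def aBar (A B G : X →ₗ.[ℝ] X) (lam : ℝ) (x : X) : ℝ :=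
  ∑' k : ℕ, -psi X (val A (katoTerm A B lam k (lam • x - val G x)) +
    val B (katoTerm A B lam k (lam • x - val G x)))

/-- Honesty: `‖V(t) u‖ - ‖u‖ = -ā (∫₀ᵗ V(s) u ds)` for all `t ≥ 0` and `u ≥ 0`, where `ā = ā_lam`
(which does not depend on `lam > 0`). -/
def IsHonest (A B : X →ₗ.[ℝ] X) (V : C0Semigroup X) (lam : ℝ) : Prop :=
  ∀ (t : ℝ≥0) (u : X), 0 ≤ u →
    ‖V.toFun t u‖ - ‖u‖ =
      -aBar A B V.generator lam (∫ s in (0 : ℝ)..t, V.toFun s.toNNReal u)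

/-- The substochastic `C₀`-semigroups whose generators are extensions of `A + B`. -/
def substochasticExtensions (A B : X →ₗ.[ℝ] X) : Set (C0Semigroup X) :=
  {W | W.IsSubstochastic ∧ A + B ≤ W.generator}

/-- The generator of `W` is `u ↦ G u + (a₀ - ā)(u) u₀` with domain `D(G)`. -/
def HasRankOneGenerator (A B G : X →ₗ.[ℝ] X) (lam : ℝ) (u₀ : X) (W : C0Semigroup X) : Prop :=
  W.generator.domain = G.domain ∧ ∀ u : X, u ∈ G.domain →
    val W.generator u = val G u + (aZero G u - aBar A B G lam u) • u₀

end Kato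

end KatoHonesty

open KatoHonesty

set_option linter.unusedSectionVars false

namespace KatoHonesty

/-! ### Bounded positive decompositions and operators controlled on the cone. -/

section Cone

variable {X : Type*} [NormedAddCommGroup X] [NormedSpace ℝ X] [PartialOrder X]
  [AbstractStateSpace X]

/-! Write R = R(λ,A) and K = B R. Testing the condition on Ψ at R u gives ‖K u‖ + λ‖R u‖ ≤ ‖u‖ for u
≥ 0. Hence K is positive and contractive on the cone, and Kato's series converges to an operator
S(λ) with λS(λ) contractive on the cone. The family S satisfies the resolvent identity and λS(λ) → 1
strongly, so a Hille–Yosida argument yields the Kato semigroup. Since operators contractive on the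
cone are closed under products and bounded in norm by one constant, no renorming is needed
(`SubstochasticResolvent.exists_semigroup`).

What governs honesty is the loss functional ell(u) = lim Ψ(Kⁿu), a decreasing limit of norms when u
≥ 0. Telescoping gives (a₀ - ā)(x) = ell(λx - Gx) (`aZero_sub_aBar`), and V is honest exactly when
ell = 0 (`isHonest_iff`).

If ell = 0, then Kⁿu → 0 in norm for u ≥ 0. For any substochastic extension with resolvent Q at λ,
the n-th partial sum of Kato's series is Q u - Q Kⁿu, so Q is the Kato resolvent
(`eq_of_loss_eq_zero`).

If ell ≠ 0, then ell ∘ (λ - G) still vanishes on D(A), because ell ∘ K = ell, so adding (ell ∘ (λ -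
G)) u₀ to G keeps an extension of A + B. The perturbed resolvent at μ is S(μ) plus a rank-one term.
It is positive and substochastic because F = ell ∘ (λ - G) S(μ) satisfies 0 ≤ F(u) ≤ ‖u‖ - μ‖S(μ)u‖
on the cone (`loss_katoResolvent_mem`): what is gained through u₀ never exceeds what V loses.
Different multiples of one u₀ give different generators. -/

theorem lp_one_summable_norm {ι : Type*} (a : lp (fun _ : ι => ℝ) 1) : Summable fun i => ‖a i‖ := by
  simpa using lp.memℓp a |>.summable (by norm_num)

theorem lp_one_norm_eq {ι : Type*} (a : lp (fun _ : ι => ℝ) 1) : ‖a‖ = ∑' i, ‖a i‖ := by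
  simpa using lp.norm_eq_tsum_rpow (p := 1) (by norm_num) a

variable (X) in
/-- Synthesis of elements of `X` from `ℓ¹`-coefficients over the positive part of the unit ball. -/
noncomputable def coneSynthesis : lp (fun _ : {u : X // 0 ≤ u ∧ ‖u‖ ≤ 1} => ℝ) 1 →L[ℝ] X :=
  have hs : ∀ a : lp (fun _ : {u : X // 0 ≤ u ∧ ‖u‖ ≤ 1} => ℝ) 1,
      Summable fun i => ‖a i • (i : X)‖ := fun a =>
    (lp_one_summable_norm a).of_nonneg_of_le (fun _ => norm_nonneg _) fun i => by
      rw [norm_smul]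
      exact mul_le_of_le_one_right (norm_nonneg _) i.2.2
  LinearMap.mkContinuous
    { toFun := fun a => ∑' i, a i • (i : X)
      map_add' := fun a b => by
        simp only [lp.coeFn_add, Pi.add_apply, add_smul]
        exact (hs a).of_norm.tsum_add (hs b).of_norm
      map_smul' := fun c a => by
        simp only [lp.coeFn_smul, Pi.smul_apply, smul_assoc, RingHom.id_apply]
        exact (hs a).of_norm.tsum_const_smul c } 1 fun a => by
    rw [one_mul, lp_one_norm_eq]
    refine (norm_tsum_le_tsum_norm (hs a)).trans ((hs a).tsum_le_tsum (fun i => ?_)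
      (lp_one_summable_norm a))
    rw [norm_smul]
    exact mul_le_of_le_one_right (norm_nonneg _) i.2.2

theorem coneSynthesis_apply (a : lp (fun _ : {u : X // 0 ≤ u ∧ ‖u‖ ≤ 1} => ℝ) 1) :
    coneSynthesis X a = ∑' i, a i • (i : X) := rfl

theorem exists_coneSynthesis_eq (u : X) (hu : 0 ≤ u) : ∃ a, coneSynthesis X a = u := by
  classical
  rcases eq_or_ne u 0 with rfl | h0
  · exact ⟨0, _root_.map_zero _⟩
  · have hn : 0 < ‖u‖ := norm_pos_iff.2 h0
    let i : {u : X // 0 ≤ u ∧ ‖u‖ ≤ 1} := ⟨‖u‖⁻¹ • u, smul_nonneg (by positivity) hu, by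
      rw [norm_smul, norm_inv, norm_norm, inv_mul_cancel₀ hn.ne']⟩
    refine ⟨lp.single 1 i ‖u‖, ?_⟩
    rw [coneSynthesis_apply, tsum_eq_single i]
    · simp [i, smul_smul, hn.ne']
    · intro j hj
      simp [lp.single_apply, hj]

-- The synthesis map from ℓ¹ is onto because the cone is generating, so the open mapping theorem
-- provides coefficients of controlled norm. Their positive and negative parts synthesize the two
-- positive vectors.
variable (X) in
theorem exists_bounded_decomposition : ∃ M : ℝ, 0 < M ∧ ∀ x : X, ∃ u v : X,
    0 ≤ u ∧ 0 ≤ v ∧ x = u - v ∧ ‖u‖ + ‖v‖ ≤ M * ‖x‖ := by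
  have hsurj : Function.Surjective (coneSynthesis X) := by
    intro x
    obtain ⟨u, v, hu, hv, rfl⟩ := AbstractStateSpace.generating x
    obtain ⟨a, rfl⟩ := exists_coneSynthesis_eq u hu
    obtain ⟨b, rfl⟩ := exists_coneSynthesis_eq v hv
    exact ⟨a - b, _root_.map_sub _ _ _⟩
  obtain ⟨C, hC, h⟩ := (coneSynthesis X).exists_preimage_norm_le hsurj
  have hsum : ∀ (a : lp (fun _ : {u : X // 0 ≤ u ∧ ‖u‖ ≤ 1} => ℝ) 1)
      (f : {u : X // 0 ≤ u ∧ ‖u‖ ≤ 1} → ℝ), (∀ i, 0 ≤ f i ∧ f i ≤ ‖a i‖) →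
      (Summable fun i => f i • (i : X)) ∧ 0 ≤ ∑' i, f i • (i : X) ∧
        ‖∑' i, f i • (i : X)‖ ≤ ‖a‖ := by
    intro a f hf
    have h1 : ∀ i, ‖f i • (i : X)‖ ≤ ‖a i‖ := fun i => by
      rw [norm_smul, Real.norm_of_nonneg (hf i).1]
      exact (mul_le_of_le_one_right (hf i).1 i.2.2).trans (hf i).2
    have h2 := (lp_one_summable_norm a).of_nonneg_of_le (fun _ => norm_nonneg _) h1
    refine ⟨h2.of_norm, tsum_nonneg fun i => smul_nonneg (hf i).1 i.2.1, ?_⟩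
    rw [lp_one_norm_eq]
    exact (norm_tsum_le_tsum_norm h2).trans (h2.tsum_le_tsum h1 (lp_one_summable_norm a))
  refine ⟨2 * C, by positivity, fun x => ?_⟩
  obtain ⟨a, rfl, ha⟩ := h x
  obtain ⟨hp, hp0, hpn⟩ := hsum a (fun i => max (a i) 0)
    fun i => ⟨le_max_right _ _, max_le (le_abs_self _) (norm_nonneg _)⟩
  obtain ⟨hm, hm0, hmn⟩ := hsum a (fun i => max (-a i) 0)
    fun i => ⟨le_max_right _ _, max_le (neg_le_abs _) (norm_nonneg _)⟩
  refine ⟨_, _, hp0, hm0, ?_, by linarith⟩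
  rw [← hp.tsum_sub hm, coneSynthesis_apply]
  congr 1
  funext i
  rw [← sub_smul]
  congr 1
  rcases le_total 0 (a i) with h0 | h0 <;> simp [h0]

variable (X) in
/-- A constant bounding the norms of the parts in some decomposition `x = u - v`, `u, v ≥ 0`. -/
noncomputable def coneConst : ℝ := Classical.choose (exists_bounded_decomposition X)

variable (X) in
theorem coneConst_pos : 0 < coneConst X :=
  (Classical.choose_spec (exists_bounded_decomposition X)).1

theorem exists_decomposition (x : X) : ∃ u v : X,
    0 ≤ u ∧ 0 ≤ v ∧ x = u - v ∧ ‖u‖ + ‖v‖ ≤ coneConst X * ‖x‖ :=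
  (Classical.choose_spec (exists_bounded_decomposition X)).2 x

/-- Makes estimates on the cone sufficient: every boundedness claim below is checked on positive
vectors only, at the cost of the factor `coneConst X`. -/
theorem norm_map_le_of_cone {Y : Type*} [NormedAddCommGroup Y] [NormedSpace ℝ Y] (T : X →ₗ[ℝ] Y)
    {c : ℝ} (hc : 0 ≤ c) (h : ∀ u : X, 0 ≤ u → ‖T u‖ ≤ c * ‖u‖) (x : X) :
    ‖T x‖ ≤ c * coneConst X * ‖x‖ := by
  obtain ⟨u, v, hu, hv, rfl, hn⟩ := exists_decomposition x
  rw [_root_.map_sub]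
  have := mul_le_mul_of_nonneg_left hn hc
  linarith [norm_sub_le (T u) (T v), h u hu, h v hv]

theorem opNorm_le_of_cone (T : X →L[ℝ] X) {c : ℝ} (hc : 0 ≤ c)
    (h : ∀ u : X, 0 ≤ u → ‖T u‖ ≤ c * ‖u‖) : ‖T‖ ≤ c * coneConst X :=
  T.opNorm_le_bound (mul_nonneg hc (coneConst_pos X).le)
    (norm_map_le_of_cone (T : X →ₗ[ℝ] X) hc h)

theorem exists_continuousLinearMap_of_cone {Y : Type*} [NormedAddCommGroup Y] [NormedSpace ℝ Y]
    (T : X →ₗ[ℝ] Y) {c : ℝ} (hc : 0 ≤ c) (h : ∀ u : X, 0 ≤ u → ‖T u‖ ≤ c * ‖u‖) :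
    ∃ S : X →L[ℝ] Y, ∀ x, S x = T x :=
  ⟨T.mkContinuous _ (norm_map_le_of_cone T hc h), fun _ => rfl⟩

theorem eq_of_eq_on_cone {Y : Type*} [AddCommGroup Y] [Module ℝ Y] {S T : X →ₗ[ℝ] Y}
    (h : ∀ u, 0 ≤ u → S u = T u) : S = T := by
  ext x
  obtain ⟨u, v, hu, hv, rfl⟩ := AbstractStateSpace.generating x
  rw [_root_.map_sub, _root_.map_sub, h u hu, h v hv]

variable (X) in
theorem continuous_psi : Continuous (psi X) := by
  obtain ⟨S, hS⟩ := exists_continuousLinearMap_of_cone (psi X) zero_le_one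
    fun u hu => by rw [psi_of_nonneg hu, norm_norm, one_mul]
  exact S.continuous.congr hS

theorem norm_sub_of_le {u v : X} (hu : 0 ≤ u) (huv : u ≤ v) : ‖v - u‖ = ‖v‖ - ‖u‖ := by
  have := AbstractStateSpace.norm_add_of_nonneg u (v - u) hu (sub_nonneg.2 huv)
  rw [add_sub_cancel] at this
  linarith

/-- A bounded operator that is positive and contractive on the positive cone. -/
def ContractiveOnCone (T : X →L[ℝ] X) : Prop := ∀ u : X, 0 ≤ u → 0 ≤ T u ∧ ‖T u‖ ≤ ‖u‖

theorem ContractiveOnCone.norm_le {T : X →L[ℝ] X} (h : ContractiveOnCone T) :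
    ‖T‖ ≤ coneConst X := by
  simpa using opNorm_le_of_cone T zero_le_one fun u hu => by simpa using (h u hu).2

theorem ContractiveOnCone.norm_apply_le {T : X →L[ℝ] X} (h : ContractiveOnCone T) (x : X) :
    ‖T x‖ ≤ coneConst X * ‖x‖ := T.le_of_opNorm_le h.norm_le x

theorem ContractiveOnCone.mul {S T : X →L[ℝ] X} (hS : ContractiveOnCone S)
    (hT : ContractiveOnCone T) : ContractiveOnCone (S * T) := fun u hu =>
  ⟨(hS _ (hT u hu).1).1, (hS _ (hT u hu).1).2.trans (hT u hu).2⟩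

theorem ContractiveOnCone.pow {T : X →L[ℝ] X} (hT : ContractiveOnCone T) (n : ℕ) :
    ContractiveOnCone (T ^ n) := by
  induction n with
  | zero => exact fun u hu => ⟨by simpa using hu, by simp⟩
  | succ n ih => exact pow_succ T n ▸ ih.mul hT

theorem ContractiveOnCone.of_tendsto {ι : Type*} {l : Filter ι} [l.NeBot] {T : ι → X →L[ℝ] X}
    (hT : ∀ i, ContractiveOnCone (T i)) {S : X →L[ℝ] X}
    (h : ∀ x, Tendsto (fun i => T i x) l (𝓝 (S x))) : ContractiveOnCone S := fun u hu =>
  ⟨ge_of_tendsto' (h u) fun i => (hT i u hu).1, le_of_tendsto' (h u).norm fun i => (hT i u hu).2⟩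

end Cone

/-! ### Graphs and resolvents of unbounded operators. -/

section Graph

variable {X : Type*} [NormedAddCommGroup X] [NormedSpace ℝ X]

theorem mk_val_mem_graph {T : X →ₗ.[ℝ] X} {x : X} (h : x ∈ T.domain) : (x, val T x) ∈ T.graph := by
  rw [val, dif_pos h]
  exact T.mem_graph ⟨x, h⟩

theorem mem_domain_of_mem_graph {T : X →ₗ.[ℝ] X} {x y : X} (h : (x, y) ∈ T.graph) :
    x ∈ T.domain := LinearPMap.mem_domain_of_mem_graph h

theorem val_eq_of_mem_graph {T : X →ₗ.[ℝ] X} {x y : X} (h : (x, y) ∈ T.graph) : val T x = y :=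
  LinearPMap.mem_graph_snd_inj T (mk_val_mem_graph (mem_domain_of_mem_graph h)) h rfl

theorem val_add {T : X →ₗ.[ℝ] X} {x y : X} (hx : x ∈ T.domain) (hy : y ∈ T.domain) :
    val T (x + y) = val T x + val T y :=
  val_eq_of_mem_graph (T.graph.add_mem (mk_val_mem_graph hx) (mk_val_mem_graph hy))

theorem val_smul {T : X →ₗ.[ℝ] X} (c : ℝ) {x : X} (hx : x ∈ T.domain) :
    val T (c • x) = c • val T x :=
  val_eq_of_mem_graph (T.graph.smul_mem c (mk_val_mem_graph hx))

theorem isResolvent_iff {T : X →ₗ.[ℝ] X} {lam : ℝ} {R : X →L[ℝ] X} :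
    IsResolvent T lam R ↔ (∀ u, (R u, lam • R u - u) ∈ T.graph) ∧
      ∀ x y, (x, y) ∈ T.graph → R (lam • x - y) = x := by
  refine and_congr (forall_congr' fun u => ?_) ?_
  · rw [LinearPMap.mem_graph_iff]
    constructor
    · rintro ⟨h, hu⟩
      refine ⟨⟨_, h⟩, rfl, ?_⟩
      simp only
      nth_rewrite 3 [← hu]
      abel
    · rintro ⟨⟨y, hy⟩, rfl, h2⟩
      exact ⟨hy, by rw [h2]; simp⟩
  · constructor
    · intro h x y hxy
      obtain ⟨z, rfl, rfl⟩ := (LinearPMap.mem_graph_iff _).1 hxy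
      exact h z
    · exact fun h x => h _ _ (T.mem_graph x)

theorem IsResolvent.mem_graph {T : X →ₗ.[ℝ] X} {lam : ℝ} {R : X →L[ℝ] X}
    (h : IsResolvent T lam R) (u : X) : (R u, lam • R u - u) ∈ T.graph :=
  (isResolvent_iff.1 h).1 u

theorem IsResolvent.apply_graph {T : X →ₗ.[ℝ] X} {lam : ℝ} {R : X →L[ℝ] X}
    (h : IsResolvent T lam R) {x y : X} (hxy : (x, y) ∈ T.graph) : R (lam • x - y) = x :=
  (isResolvent_iff.1 h).2 x y hxy

theorem IsResolvent.mem_domain {T : X →ₗ.[ℝ] X} {lam : ℝ} {R : X →L[ℝ] X}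
    (h : IsResolvent T lam R) (u : X) : R u ∈ T.domain :=
  mem_domain_of_mem_graph (h.mem_graph u)

theorem IsResolvent.val_apply {T : X →ₗ.[ℝ] X} {lam : ℝ} {R : X →L[ℝ] X}
    (h : IsResolvent T lam R) (u : X) : val T (R u) = lam • R u - u :=
  val_eq_of_mem_graph (h.mem_graph u)

theorem IsResolvent.mem_graph_iff {T : X →ₗ.[ℝ] X} {lam : ℝ} {R : X →L[ℝ] X}
    (h : IsResolvent T lam R) {x y : X} : (x, y) ∈ T.graph ↔ R (lam • x - y) = x := by
  refine ⟨h.apply_graph, fun hR => ?_⟩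
  have := h.mem_graph (lam • x - y)
  rwa [hR, sub_sub_cancel] at this

/-- The graph can be read off from one resolvent, so generators are compared through a single value
of the parameter. -/
theorem IsResolvent.eq {S T : X →ₗ.[ℝ] X} {lam : ℝ} {R : X →L[ℝ] X}
    (hS : IsResolvent S lam R) (hT : IsResolvent T lam R) : S = T :=
  LinearPMap.eq_of_eq_graph (by ext ⟨x, y⟩; rw [hS.mem_graph_iff, hT.mem_graph_iff])

theorem IsResolvent.resolvent_identity {T : X →ₗ.[ℝ] X} {lam mu : ℝ} {R S : X →L[ℝ] X}
    (hR : IsResolvent T lam R) (hS : IsResolvent T mu S) (x : X) :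
    R x - S x = (mu - lam) • R (S x) := by
  have h := hR.apply_graph (hS.mem_graph x)
  rw [show lam • S x - (mu • S x - x) = x - (mu - lam) • S x by rw [sub_smul]; abel,
    _root_.map_sub, map_smul] at h
  nth_rewrite 1 [← h]
  abel

end Graph

/-! ### Orbits of substochastic semigroups and their generators. -/

namespace C0Semigroup

section Integral

variable {X : Type*} [NormedAddCommGroup X] [NormedSpace ℝ X] [CompleteSpace X]

theorem tendsto_coe_nhdsGT_zero : Tendsto ((↑) : ℝ≥0 → ℝ) (𝓝[>] 0) (𝓝[>] 0) := by
  refine tendsto_nhdsWithin_iff.2 ⟨?_, ?_⟩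
  · exact tendsto_nhdsWithin_of_tendsto_nhds (NNReal.continuous_coe.tendsto' 0 0 rfl)
  · filter_upwards [self_mem_nhdsWithin] with t ht using NNReal.coe_pos.2 ht

theorem tendsto_average {f : ℝ → X} (hf : Continuous f) (a : ℝ) :
    Tendsto (fun h : ℝ≥0 => (h : ℝ)⁻¹ • ∫ s in a..a + h, f s) (𝓝[>] 0) (𝓝 (f a)) := by
  have h1 := (intervalIntegral.integral_hasDerivAt_right (hf.intervalIntegrable a a)
    (hf.stronglyMeasurableAtFilter _ _) hf.continuousAt).tendsto_slope_zero_right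
  simpa [Function.comp_def] using h1.comp tendsto_coe_nhdsGT_zero

end Integral

variable {X : Type*} [NormedAddCommGroup X] [NormedSpace ℝ X] [PartialOrder X]
  [AbstractStateSpace X] {V W : C0Semigroup X}

theorem IsSubstochastic.contractive (hV : V.IsSubstochastic) (t : ℝ≥0) :
    ContractiveOnCone (V.toFun t) := hV t

theorem map_add_apply (V : C0Semigroup X) (s t : ℝ≥0) (x : X) :
    V.toFun (s + t) x = V.toFun s (V.toFun t x) := by
  rw [V.map_add]
  rfl

theorem comm_apply (V : C0Semigroup X) (s t : ℝ≥0) (x : X) :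
    V.toFun s (V.toFun t x) = V.toFun t (V.toFun s x) := by
  rw [← map_add_apply, add_comm, map_add_apply]

theorem IsSubstochastic.norm_sub_le (hV : V.IsSubstochastic) (s t : ℝ≥0) (x : X) :
    ‖V.toFun s x - V.toFun t x‖ ≤ coneConst X * ‖V.toFun (nndist s t) x - x‖ := by
  wlog h : t ≤ s generalizing s t
  · rw [norm_sub_rev, nndist_comm]
    exact this t s (le_of_not_ge h)
  have h1 : s = t + nndist s t := by
    rw [NNReal.nndist_eq, tsub_eq_zero_of_le h, max_eq_left zero_le, add_tsub_cancel_of_le h]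
  nth_rewrite 1 [h1]
  rw [map_add_apply, ← _root_.map_sub]
  exact (hV.contractive t).norm_apply_le _

theorem IsSubstochastic.continuous (hV : V.IsSubstochastic) (x : X) :
    Continuous fun t => V.toFun t x := by
  refine continuous_iff_continuousAt.2 fun t => tendsto_iff_norm_sub_tendsto_zero.2 ?_
  refine squeeze_zero (fun _ => norm_nonneg _) (fun s => hV.norm_sub_le s t x) ?_
  have h1 : Tendsto (fun s => nndist s t) (𝓝 t) (𝓝 0) :=
    (continuous_id.nndist continuous_const).tendsto' t 0 (by simp)
  have h2 := tendsto_iff_norm_sub_tendsto_zero.1 ((V.tendsto_zero x).comp h1)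
  simpa using h2.const_mul (coneConst X)

theorem IsSubstochastic.continuous_real (hV : V.IsSubstochastic) (x : X) :
    Continuous fun t : ℝ => V.toFun t.toNNReal x :=
  (hV.continuous x).comp continuous_real_toNNReal

theorem IsSubstochastic.tendsto_apply (hV : V.IsSubstochastic) {ι : Type*} {l : Filter ι}
    {t : ι → ℝ≥0} {x : ι → X} {t₀ : ℝ≥0} {x₀ : X} (ht : Tendsto t l (𝓝 t₀))
    (hx : Tendsto x l (𝓝 x₀)) : Tendsto (fun i => V.toFun (t i) (x i)) l (𝓝 (V.toFun t₀ x₀)) := by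
  have h1 : Tendsto (fun i => V.toFun (t i) (x i - x₀)) l (𝓝 0) := by
    refine squeeze_zero_norm (fun i => (hV.contractive (t i)).norm_apply_le _) ?_
    simpa using (tendsto_iff_norm_sub_tendsto_zero.1 hx).const_mul (coneConst X)
  simpa using h1.add (((hV.continuous x₀).tendsto t₀).comp ht)

theorem apply_shift (V : C0Semigroup X) (h : ℝ≥0) {s : ℝ} (hs : 0 ≤ s) (x : X) :
    V.toFun h (V.toFun s.toNNReal x) = V.toFun (s + h).toNNReal x := by
  rw [← map_add_apply, Real.toNNReal_add hs h.coe_nonneg, Real.toNNReal_coe, add_comm]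

/-- V(h) shifts the window of integration to [h, t + h]. In the difference only the two end pieces
survive, and their averages converge to V(t)x and x. -/
theorem IsSubstochastic.integral_mem_graph (hV : V.IsSubstochastic) (t : ℝ≥0) (x : X) :
    (∫ s in (0 : ℝ)..t, V.toFun s.toNNReal x, V.toFun t x - x) ∈ V.generator.graph := by
  rw [mem_graph_generator]
  have hc := hV.continuous_real x
  have hi := fun a b => hc.intervalIntegrable (μ := MeasureTheory.volume) a b
  have h1 := (tendsto_average hc t).sub (tendsto_average hc 0)
  simp only [Real.toNNReal_coe, Real.toNNReal_zero, V.map_zero, ContinuousLinearMap.coe_id', id]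
    at h1
  refine h1.congr fun h => ?_
  rw [← smul_sub]
  congr 1
  have h2 : V.toFun h (∫ s in (0 : ℝ)..t, V.toFun s.toNNReal x) =
      ∫ s in (h : ℝ)..t + h, V.toFun s.toNNReal x := by
    rw [← ContinuousLinearMap.intervalIntegral_comp_comm _ (hi _ _),
      show ∫ s in (h : ℝ)..t + h, V.toFun s.toNNReal x = ∫ s in (0 : ℝ) + h..t + h,
        V.toFun s.toNNReal x by rw [zero_add],
      ← intervalIntegral.integral_comp_add_right (fun s => V.toFun s.toNNReal x)]
    refine intervalIntegral.integral_congr fun s hs => ?_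
    rw [Set.uIcc_of_le t.coe_nonneg] at hs
    simpa using V.apply_shift h hs.1 x
  have h3 := (intervalIntegral.integral_add_adjacent_intervals (hi 0 h) (hi h (t + h))).trans
    (intervalIntegral.integral_add_adjacent_intervals (hi 0 t) (hi t (t + h))).symm
  rw [h2, zero_add, sub_eq_sub_iff_add_eq_add, add_comm, ← h3, add_comm]

theorem IsSubstochastic.tendsto_integral_average (hV : V.IsSubstochastic) (x : X) :
    Tendsto (fun h : ℝ≥0 => (h : ℝ)⁻¹ • ∫ s in (0 : ℝ)..h, V.toFun s.toNNReal x)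
      (𝓝[>] 0) (𝓝 x) := by
  simpa [V.map_zero] using tendsto_average (hV.continuous_real x) 0

theorem IsSubstochastic.dense_domain (hV : V.IsSubstochastic) :
    Dense (V.generator.domain : Set X) := fun x =>
  mem_closure_of_tendsto (hV.tendsto_integral_average x) (Eventually.of_forall fun h =>
    V.generator.domain.smul_mem _ (mem_domain_of_mem_graph (hV.integral_mem_graph h x)))

theorem apply_mem_graph {x y : X} (h : (x, y) ∈ V.generator.graph) {S : X →L[ℝ] X}
    (hS : ∀ t z, S (V.toFun t z) = V.toFun t (S z)) : (S x, S y) ∈ V.generator.graph := by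
  rw [mem_graph_generator] at h ⊢
  refine ((S.continuous.tendsto y).comp h).congr fun t => ?_
  simp [hS]

end C0Semigroup

open MeasureTheory

/-! ### Strong convergence from dense subsets. -/

section

variable {X : Type*} [NormedAddCommGroup X] [NormedSpace ℝ X] [PartialOrder X]
  [AbstractStateSpace X]

instance : IsOrderedModule ℝ X where
  smul_le_smul_of_nonneg_right u hu a b hab := by
    rw [← sub_nonneg, ← sub_smul]
    exact smul_nonneg (sub_nonneg.2 hab) hu

theorem tendsto_of_dense {ι : Type*} {l : Filter ι} {T : ι → X →L[ℝ] X} {L : X →L[ℝ] X} {M : ℝ}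
    (hT : ∀ᶠ i in l, ∀ x, ‖T i x‖ ≤ M * ‖x‖) {S : Set X} (hS : Dense S)
    (h : ∀ x ∈ S, Tendsto (fun i => T i x) l (𝓝 (L x))) (x : X) :
    Tendsto (fun i => T i x) l (𝓝 (L x)) := by
  rw [Metric.tendsto_nhds]
  intro ε hε
  set C := max M 0 + ‖L‖ + 1
  have hC : 0 < C := by positivity
  obtain ⟨y, hy, hxy⟩ := hS.exists_dist_lt x (ε := ε / 2 / C) (by positivity)
  rw [dist_eq_norm, lt_div_iff₀ hC] at hxy
  filter_upwards [hT, Metric.tendsto_nhds.1 (h y hy) (ε / 2) (by positivity)] with i hi hiy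
  rw [dist_eq_norm] at hiy ⊢
  have h1 : T i x - L x = T i (x - y) - L (x - y) + (T i y - L y) := by
    simp only [_root_.map_sub]; abel
  have h2 := (hi (x - y)).trans (mul_le_mul_of_nonneg_right (le_max_left M 0) (norm_nonneg _))
  have h3 := L.le_opNorm (x - y)
  rw [h1]
  calc _ ≤ ‖T i (x - y)‖ + ‖L (x - y)‖ + ‖T i y - L y‖ :=
        (norm_add_le _ _).trans (add_le_add_left (norm_sub_le _ _) _)
    _ < ε := by
        have : ‖x - y‖ * C = max M 0 * ‖x - y‖ + ‖L‖ * ‖x - y‖ + ‖x - y‖ := by ring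
        linarith [norm_nonneg (x - y)]

theorem cauchySeq_of_dense {T : ℕ → X →L[ℝ] X} {M : ℝ}
    (hT : ∀ i x, ‖T i x‖ ≤ M * ‖x‖) {S : Set X} (hS : Dense S)
    (h : ∀ x ∈ S, CauchySeq fun i => T i x) (x : X) : CauchySeq fun i => T i x := by
  rw [Metric.cauchySeq_iff]
  intro ε hε
  set C := max M 0 + 1
  have hC : 0 < C := by positivity
  obtain ⟨y, hy, hxy⟩ := hS.exists_dist_lt x (ε := ε / 3 / C) (by positivity)
  rw [dist_eq_norm, lt_div_iff₀ hC] at hxy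
  obtain ⟨N, hN⟩ := Metric.cauchySeq_iff.1 (h y hy) (ε / 3) (by positivity)
  have hb : ∀ i, dist (T i x) (T i y) < ε / 3 := fun i => by
    rw [dist_eq_norm, ← _root_.map_sub]
    have h2 := (hT i (x - y)).trans (mul_le_mul_of_nonneg_right (le_max_left M 0) (norm_nonneg _))
    have : ‖x - y‖ * C = max M 0 * ‖x - y‖ + ‖x - y‖ := by ring
    linarith [norm_nonneg (x - y)]
  refine ⟨N, fun m hm n hn => ?_⟩
  linarith [dist_triangle4_right (T m x) (T n x) (T m y) (T n y), hb m, hb n, hN m hm n hn]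

/-- On D(G) one has λR(λ)x - x = R(λ)Gx, of order 1/λ. Density and the uniform bound do the rest. -/
theorem tendsto_smul_resolvent {G : X →ₗ.[ℝ] X} (hG : Dense (G.domain : Set X))
    {R : ℝ → X →L[ℝ] X} (hR : ∀ lam, 0 < lam → IsResolvent G lam (R lam))
    (hc : ∀ lam, 0 < lam → ContractiveOnCone (lam • R lam)) (x : X) :
    Tendsto (fun lam => lam • R lam x) atTop (𝓝 x) := by
  refine tendsto_of_dense (T := fun lam => lam • R lam) (L := ContinuousLinearMap.id ℝ X)
    (M := coneConst X) ?_ hG ?_ x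
  · filter_upwards [eventually_gt_atTop 0] with lam hlam x using (hc lam hlam).norm_apply_le x
  · intro x hx
    have hx := mk_val_mem_graph hx
    rw [tendsto_iff_norm_sub_tendsto_zero]
    have h1 : Tendsto (fun lam : ℝ => lam⁻¹ * (coneConst X * ‖val G x‖)) atTop (𝓝 0) := by
      simpa using tendsto_inv_atTop_zero.mul_const (coneConst X * ‖val G x‖)
    refine squeeze_zero' (Eventually.of_forall fun _ => norm_nonneg _) ?_ h1
    filter_upwards [eventually_gt_atTop 0] with lam hlam
    have h2 := (hR lam hlam).apply_graph hx
    rw [_root_.map_sub, map_smul] at h2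
    have h3 := (hc lam hlam).norm_apply_le (val G x)
    rw [_root_.smul_apply, norm_smul, Real.norm_of_nonneg hlam.le] at h3
    rw [_root_.smul_apply, ContinuousLinearMap.id_apply,
      show lam • R lam x - x = R lam (val G x) by nth_rewrite 2 [← h2]; abel]
    rwa [inv_mul_eq_div, le_div_iff₀' hlam]

end

/-! ### The resolvent as Laplace transform; a generator determines its semigroup. -/

namespace C0Semigroup

variable {X : Type*} [NormedAddCommGroup X] [NormedSpace ℝ X] [PartialOrder X]
  [AbstractStateSpace X] {V W : C0Semigroup X}

/-- The Laplace transform of an orbit. -/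
noncomputable def laplace (V : C0Semigroup X) (lam : ℝ) (x : X) : X :=
  ∫ s in Set.Ioi (0 : ℝ), Real.exp (-lam * s) • V.toFun s.toNNReal x

variable {lam : ℝ}

theorem IsSubstochastic.continuous_laplace_integrand (hV : V.IsSubstochastic) (lam : ℝ) (x : X) :
    Continuous fun s : ℝ => Real.exp (-lam * s) • V.toFun s.toNNReal x :=
  (by fun_prop : Continuous fun s : ℝ => Real.exp (-lam * s)).smul (hV.continuous_real x)

theorem IsSubstochastic.integrableOn_laplace (hV : V.IsSubstochastic) (hlam : 0 < lam) (x : X) :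
    IntegrableOn (fun s : ℝ => Real.exp (-lam * s) • V.toFun s.toNNReal x) (Set.Ioi 0) := by
  refine Integrable.mono' ((integrableOn_exp_mul_Ioi (neg_lt_zero.2 hlam) 0).mul_const
    (coneConst X * ‖x‖)) (hV.continuous_laplace_integrand lam x).aestronglyMeasurable ?_
  refine Eventually.of_forall fun s => ?_
  rw [norm_smul, Real.norm_of_nonneg (Real.exp_pos _).le]
  exact mul_le_mul_of_nonneg_left ((hV.contractive _).norm_apply_le x) (Real.exp_pos _).le

theorem IsSubstochastic.laplace_nonneg (hV : V.IsSubstochastic) {u : X} (hu : 0 ≤ u) :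
    0 ≤ V.laplace lam u :=
  integral_nonneg fun _ => smul_nonneg (Real.exp_pos _).le (hV _ u hu).1

theorem IsSubstochastic.norm_laplace_le (hV : V.IsSubstochastic) (hlam : 0 < lam) {u : X}
    (hu : 0 ≤ u) : ‖V.laplace lam u‖ ≤ lam⁻¹ * ‖u‖ := by
  have h1 := integral_exp_mul_Ioi (neg_lt_zero.2 hlam) 0
  have h2 : lam⁻¹ * ‖u‖ = ∫ s in Set.Ioi (0 : ℝ), Real.exp (-lam * s) * ‖u‖ := by
    rw [integral_mul_const, h1]
    simp
  rw [h2]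
  refine norm_integral_le_of_norm_le
    ((integrableOn_exp_mul_Ioi (neg_lt_zero.2 hlam) 0).mul_const ‖u‖) ?_
  refine Eventually.of_forall fun s => ?_
  rw [norm_smul, Real.norm_of_nonneg (Real.exp_pos _).le]
  exact mul_le_mul_of_nonneg_left (hV _ u hu).2 (Real.exp_pos _).le

theorem IsSubstochastic.apply_laplace (hV : V.IsSubstochastic) (hlam : 0 < lam) (h : ℝ≥0) (x : X) :
    V.toFun h (V.laplace lam x) = V.laplace lam (V.toFun h x) := by
  rw [laplace, laplace, ← ContinuousLinearMap.integral_comp_comm _ (hV.integrableOn_laplace hlam x)]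
  congr 1
  ext s
  rw [map_smul, comm_apply]

/-- Translating the integration variable by h produces the factor exp(λh) and removes the integral
over [0, h]; differentiating this at h = 0 yields the resolvent equation. -/
theorem IsSubstochastic.apply_laplace_eq (hV : V.IsSubstochastic) (hlam : 0 < lam) (h : ℝ≥0)
    (x : X) : V.toFun h (V.laplace lam x) = Real.exp (lam * h) •
      (V.laplace lam x - ∫ s in (0 : ℝ)..h, Real.exp (-lam * s) • V.toFun s.toNNReal x) := by
  have hi := hV.integrableOn_laplace hlam x
  have h1 := intervalIntegral.integral_interval_add_Ioi hi
    (hi.mono_set (Set.Ioi_subset_Ioi h.coe_nonneg))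
  have h2 := (measurePreserving_add_right volume (h : ℝ)).setIntegral_preimage_emb
    (measurableEmbedding_addRight (h : ℝ))
    (fun s : ℝ => Real.exp (-lam * s) • V.toFun s.toNNReal x) (Set.Ioi (h : ℝ))
  rw [Set.preimage_add_const_Ioi, sub_self] at h2
  rw [laplace, ← h1, add_sub_cancel_left, h1, ← h2, ← integral_smul,
    ← ContinuousLinearMap.integral_comp_comm _ hi]
  refine setIntegral_congr_fun measurableSet_Ioi fun s hs => ?_
  simp only [map_smul]
  rw [V.apply_shift h (le_of_lt hs), smul_smul, ← Real.exp_add]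
  congr 2
  ring

theorem IsSubstochastic.laplace_mem_graph (hV : V.IsSubstochastic) (hlam : 0 < lam) (x : X) :
    (V.laplace lam x, lam • V.laplace lam x - x) ∈ V.generator.graph := by
  rw [mem_graph_generator]
  have h1 : Tendsto (fun h : ℝ≥0 => (h : ℝ)⁻¹ • (Real.exp (lam * h) - 1)) (𝓝[>] 0) (𝓝 lam) := by
    have : HasDerivAt (fun h : ℝ => Real.exp (lam * h)) lam 0 := by
      simpa using ((hasDerivAt_id (0 : ℝ)).const_mul lam).exp
    simpa [Function.comp_def] using this.tendsto_slope_zero_right.comp tendsto_coe_nhdsGT_zero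
  have h2 : Tendsto (fun h : ℝ≥0 => Real.exp (lam * h)) (𝓝[>] 0) (𝓝 1) :=
    tendsto_nhdsWithin_of_tendsto_nhds
      ((by fun_prop : Continuous fun h : ℝ≥0 => Real.exp (lam * h)).tendsto' 0 1 (by simp))
  have h3 := tendsto_average (hV.continuous_laplace_integrand lam x) 0
  simp only [mul_zero, Real.exp_zero, one_smul, Real.toNNReal_zero, V.map_zero,
    ContinuousLinearMap.coe_id', id, zero_add] at h3
  have h4 := (h1.smul_const (V.laplace lam x)).sub (h2.smul h3)
  rw [one_smul] at h4
  refine h4.congr fun h => ?_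
  rw [hV.apply_laplace_eq hlam, smul_sub (Real.exp (lam * h)), smul_comm (Real.exp (lam * h)),
    smul_assoc, ← smul_sub, sub_smul, one_smul]
  congr 1
  abel

theorem IsSubstochastic.exists_laplace_eq (hV : V.IsSubstochastic) (hlam : 0 < lam) :
    ∃ R : X →L[ℝ] X, ∀ x, R x = V.laplace lam x :=
  exists_continuousLinearMap_of_cone
    { toFun := V.laplace lam
      map_add' := fun x y => by
        simp only [laplace, _root_.map_add, smul_add]
        exact integral_add (hV.integrableOn_laplace hlam x) (hV.integrableOn_laplace hlam y)
      map_smul' := fun c x => by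
        simp only [laplace, map_smul, RingHom.id_apply]
        rw [← integral_smul]
        simp only [smul_comm c] } (inv_nonneg.2 hlam.le) fun _ hu => hV.norm_laplace_le hlam hu

theorem IsSubstochastic.exists_isResolvent (hV : V.IsSubstochastic) (hlam : 0 < lam) :
    ∃ R : X →L[ℝ] X, IsResolvent V.generator lam R ∧ ContractiveOnCone (lam • R) := by
  obtain ⟨R, hR⟩ := hV.exists_laplace_eq hlam
  have hg : ∀ x, (R x, lam • R x - x) ∈ V.generator.graph := fun x => by
    rw [hR]
    exact hV.laplace_mem_graph hlam x
  refine ⟨R, isResolvent_iff.2 ⟨hg, fun x y hxy => ?_⟩, fun u hu => ⟨?_, ?_⟩⟩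
  -- The left inverse property comes from commutation: R commutes with the semigroup, so it maps the
  -- graph of the generator into itself.
  · have h1 := apply_mem_graph (S := R) hxy fun t z => by rw [hR, hR, hV.apply_laplace hlam]
    have h2 := LinearPMap.mem_graph_snd_inj _ h1 (hg x) rfl
    rw [_root_.map_sub, h2, map_smul, sub_sub_cancel]
  · rw [_root_.smul_apply, hR]
    exact smul_nonneg hlam.le (hV.laplace_nonneg hu)
  · rw [_root_.smul_apply, hR, norm_smul, Real.norm_of_nonneg hlam.le,
      ← le_inv_mul_iff₀ hlam]
    exact hV.norm_laplace_le hlam hu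

theorem IsSubstochastic.isResolvent (hV : V.IsSubstochastic) (hlam : 0 < lam) :
    IsResolvent V.generator lam (resolventOp V.generator lam) := by
  obtain ⟨R, hR, -⟩ := hV.exists_isResolvent hlam
  rwa [hR.resolventOp_eq]

theorem IsSubstochastic.contractive_resolvent (hV : V.IsSubstochastic) (hlam : 0 < lam) :
    ContractiveOnCone (lam • resolventOp V.generator lam) := by
  obtain ⟨R, hR, h⟩ := hV.exists_isResolvent hlam
  rwa [hR.resolventOp_eq]

theorem apply_domain (t : ℝ≥0) {x : X}
    (hx : x ∈ V.generator.domain) : V.toFun t x ∈ V.generator.domain :=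
  mem_domain_of_mem_graph (apply_mem_graph (mk_val_mem_graph hx) fun s z => V.comm_apply t s z)

/-- The path s ↦ V(t - s)W(s)x joins V(t)x to W(t)x, and its right derivative vanishes because the
two generators agree at W(s)x. A right derivative suffices for constancy of a continuous function.
-/
theorem IsSubstochastic.apply_eq_of_generator_eq (hV : V.IsSubstochastic) (hW : W.IsSubstochastic)
    (h : V.generator = W.generator) {x : X} (hx : x ∈ W.generator.domain) (t : ℝ≥0) :
    V.toFun t x = W.toFun t x := by
  set f : ℝ → X := fun s => V.toFun (t - s : ℝ).toNNReal (W.toFun s.toNNReal x) with hf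
  have hcont : Continuous f := by
    refine continuous_iff_continuousAt.2 fun s => hV.tendsto_apply ?_ ?_
    · exact (by fun_prop : Continuous fun s : ℝ => (t - s : ℝ).toNNReal).tendsto s
    · exact (hW.continuous_real x).tendsto s
  have hderiv : ∀ s ∈ Set.Ico (0 : ℝ) t, HasDerivWithinAt f 0 (Set.Ici s) s := by
    intro s hs
    rw [← hasDerivWithinAt_Ioi_iff_Ici, hasDerivWithinAt_iff_tendsto_slope'
      (Set.self_notMem_Ioi)]
    set y := W.toFun s.toNNReal x
    have hy := mk_val_mem_graph (apply_domain s.toNNReal hx)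
    have hyV := hy
    nth_rewrite 1 [← h] at hyV
    rw [mem_graph_generator] at hy hyV
    have h1 := hy.sub hyV
    rw [sub_self] at h1
    have h2 : Tendsto (fun r : ℝ => (r - s).toNNReal) (𝓝[>] s) (𝓝[>] 0) := by
      refine tendsto_nhdsWithin_iff.2 ⟨tendsto_nhdsWithin_of_tendsto_nhds
        ((by fun_prop : Continuous fun r : ℝ => (r - s).toNNReal).tendsto' s 0 (by simp)), ?_⟩
      filter_upwards [self_mem_nhdsWithin] with r hr
      simpa using hr
    have h3 : Tendsto (fun r : ℝ => (t - r : ℝ).toNNReal) (𝓝[>] s) (𝓝 (t - s : ℝ).toNNReal) :=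
      tendsto_nhdsWithin_of_tendsto_nhds
        ((by fun_prop : Continuous fun r : ℝ => (t - r : ℝ).toNNReal).tendsto s)
    have h4 := hV.tendsto_apply h3 (h1.comp h2)
    rw [_root_.map_zero] at h4
    refine h4.congr' ?_
    filter_upwards [Ioo_mem_nhdsGT hs.2] with r hr
    have h5 : (0 : ℝ) ≤ r - s := by linarith [hr.1]
    have h6 : r.toNNReal = (r - s).toNNReal + s.toNNReal := by
      rw [← Real.toNNReal_add h5 hs.1, sub_add_cancel]
    have h7 : (t - s : ℝ).toNNReal = (t - r : ℝ).toNNReal + (r - s).toNNReal := by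
      rw [← Real.toNNReal_add (by linarith [hr.2]) h5, sub_add_sub_cancel]
    simp only [Function.comp, slope, vsub_eq_sub, hf, h6, h7, map_add_apply, ← smul_sub, map_smul,
      ← _root_.map_sub, Real.coe_toNNReal _ h5, sub_sub_sub_cancel_right]
  have := constant_of_has_deriv_right_zero hcont.continuousOn hderiv t ⟨t.coe_nonneg, le_rfl⟩
  simpa [hf, V.map_zero, W.map_zero] using this.symm

theorem IsSubstochastic.eq_of_generator_eq (hV : V.IsSubstochastic) (hW : W.IsSubstochastic)
    (h : V.generator = W.generator) : V = W := by
  ext t x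
  revert x
  rw [← funext_iff]
  exact Continuous.ext_on hW.dense_domain (V.toFun t).continuous (W.toFun t).continuous
    fun x hx => hV.apply_eq_of_generator_eq hW h hx t

end C0Semigroup

/-! ### Exponentials of bounded operators and a Hille–Yosida theorem on the cone. -/

variable {X : Type*} [NormedAddCommGroup X] [NormedSpace ℝ X] [PartialOrder X]
  [AbstractStateSpace X]

theorem exp_add_eq_mul_of_commute {a b : X →L[ℝ] X} (h : Commute a b) :
    NormedSpace.exp (a + b) = NormedSpace.exp a * NormedSpace.exp b :=
  letI := NormedAlgebra.restrictScalars ℚ ℝ (X →L[ℝ] X)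
  NormedSpace.exp_add_of_commute h

theorem continuous_exp_smul_apply (a : X →L[ℝ] X) (x : X) :
    Continuous fun s : ℝ => NormedSpace.exp (s • a) x :=
  (continuous_iff_continuousAt.2 fun s => (hasDerivAt_exp_smul_const a s).continuousAt).clm_apply
    continuous_const

-- exp(t(P - 1)) is the Poisson average of the powers Pⁿ, with weights exp(-t) tⁿ/n!, and each power
-- is contractive on the cone.
open NormedSpace in
theorem ContractiveOnCone.exp_smul_sub_one {P : X →L[ℝ] X} (hP : ContractiveOnCone P) {t : ℝ} (ht : 0 ≤ t) :
    ContractiveOnCone (exp (t • (P - 1))) := by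
  have h1 : exp (t • (P - 1)) = Real.exp (-t) • exp (t • P) := by
    rw [show t • (P - 1) = algebraMap ℝ (X →L[ℝ] X) (-t) + t • P by
      rw [Algebra.algebraMap_eq_smul_one, smul_sub, neg_smul]; abel,
      exp_add_eq_mul_of_commute (Algebra.commute_algebraMap_left (-t) _), ← algebraMap_exp_comm, ← Real.exp_eq_exp_ℝ,
      ← Algebra.smul_def]
  intro u hu
  have h2 : HasSum (fun n : ℕ => (t ^ n / n.factorial) • (P ^ n) u) (exp (t • P) u) := by
    have := (exp_series_hasSum_exp' (𝕂 := ℝ) (t • P)).mapL (ContinuousLinearMap.apply ℝ X u)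
    simpa [smul_pow, smul_smul, div_eq_inv_mul] using this
  have h3 : HasSum (fun n : ℕ => t ^ n / n.factorial * ‖u‖) (Real.exp t * ‖u‖) := by
    refine HasSum.mul_right _ ?_
    rw [Real.exp_eq_exp_ℝ]
    exact expSeries_div_hasSum_exp t
  have h4 : ∀ n : ℕ, 0 ≤ t ^ n / n.factorial := fun n => by positivity
  rw [h1, _root_.smul_apply]
  refine ⟨smul_nonneg (Real.exp_pos _).le
    (h2.nonneg fun n => smul_nonneg (h4 n) (hP.pow n u hu).1), ?_⟩
  have h5 : ‖exp (t • P) u‖ ≤ Real.exp t * ‖u‖ := by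
    rw [← h2.tsum_eq]
    refine tsum_of_norm_bounded h3 fun n => ?_
    rw [norm_smul, Real.norm_of_nonneg (h4 n)]
    exact mul_le_mul_of_nonneg_left (hP.pow n u hu).2 (h4 n)
  rw [norm_smul, Real.norm_of_nonneg (Real.exp_pos _).le, Real.exp_neg, inv_mul_le_iff₀
    (Real.exp_pos t)]
  exact h5

-- Differentiate the interpolation exp((t - s)a) exp(sb)x in s. Each of the two exponentials costs
-- one factor `coneConst X`.
open NormedSpace in
theorem norm_exp_sub_exp_le {a b : X →L[ℝ] X} (hab : Commute a b)
    (ha : ∀ t : ℝ, 0 ≤ t → ContractiveOnCone (exp (t • a)))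
    (hb : ∀ t : ℝ, 0 ≤ t → ContractiveOnCone (exp (t • b))) {t : ℝ} (ht : 0 ≤ t) (x : X) :
    ‖exp (t • b) x - exp (t • a) x‖ ≤ coneConst X * (coneConst X * ‖b x - a x‖) * t := by
  have hf : ∀ s : ℝ, exp (t • a) * exp (s • (b - a)) = exp ((t - s) • a) * exp (s • b) := by
    intro s
    have hc : Commute ((t - s) • a) (s • b) := (hab.smul_left _).smul_right _
    have hc' : Commute (t • a) (s • (b - a)) :=
      ((hab.sub_right (Commute.refl a)).smul_left _).smul_right _
    rw [← exp_add_eq_mul_of_commute hc, ← exp_add_eq_mul_of_commute hc']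
    congr 1
    rw [smul_sub, sub_smul]
    abel
  have hd : ∀ s : ℝ, HasDerivAt (fun s : ℝ => (exp (t • a) * exp (s • (b - a))) x)
      ((exp ((t - s) • a) * exp (s • b)) (b x - a x)) s := by
    intro s
    have h1 := ((hasDerivAt_exp_smul_const (b - a) s).const_mul (exp (t • a))).clm_apply
      (hasDerivAt_const s x)
    rw [← mul_assoc, hf] at h1
    simpa using h1
  have := norm_image_sub_le_of_norm_deriv_le_segment' (a := 0) (b := t)
    (C := coneConst X * (coneConst X * ‖b x - a x‖))
    (fun s _ => (hd s).hasDerivWithinAt) (fun s hs => ?_) t ⟨ht, le_rfl⟩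
  · rw [hf t] at this
    simpa using this
  · refine ((ha _ (sub_nonneg.2 hs.2.le)).norm_apply_le _).trans ?_
    exact mul_le_mul_of_nonneg_left ((hb _ hs.1).norm_apply_le _) (coneConst_pos X).le

open NormedSpace in
theorem exp_apply_sub_eq_integral (a : X →L[ℝ] X) (t : ℝ) (x : X) :
    exp (t • a) x - x = ∫ s in (0 : ℝ)..t, exp (s • a) (a x) := by
  have hd : ∀ s : ℝ, HasDerivAt (fun s : ℝ => exp (s • a) x) (exp (s • a) (a x)) s := fun s => by
    simpa using (hasDerivAt_exp_smul_const a s).clm_apply (hasDerivAt_const s x)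
  rw [intervalIntegral.integral_eq_sub_of_hasDerivAt (fun s _ => hd s) 
    ((continuous_exp_smul_apply a (a x)).intervalIntegrable _ _)]
  simp

/-- A family of operators with the properties of the resolvent of the generator of a
substochastic semigroup. -/
structure SubstochasticResolvent (R : ℝ → X →L[ℝ] X) : Prop where
  contractive : ∀ lam, 0 < lam → ContractiveOnCone (lam • R lam)
  identity : ∀ lam mu, 0 < lam → 0 < mu → ∀ x, R lam x - R mu x = (mu - lam) • R lam (R mu x)
  tendsto : ∀ x, Tendsto (fun lam => lam • R lam x) atTop (𝓝 x)

namespace SubstochasticResolvent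

variable {R : ℝ → X →L[ℝ] X}

theorem commute (hR : SubstochasticResolvent R) {lam mu : ℝ} (hlam : 0 < lam) (hmu : 0 < mu) :
    Commute (R lam) (R mu) := by
  rcases eq_or_ne lam mu with rfl | h
  · exact Commute.refl _
  · ext x
    have h1 := hR.identity lam mu hlam hmu x
    have h2 := hR.identity mu lam hmu hlam x
    rw [← neg_sub (R lam x), h1, ← neg_sub mu lam, neg_smul, neg_inj] at h2
    exact smul_right_injective X (sub_ne_zero.2 h.symm) h2

/-- The bounded Yosida approximations of the generator. -/
noncomputable def yosida (R : ℝ → X →L[ℝ] X) (n : ℕ) : X →L[ℝ] X :=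
  ((n : ℝ) + 1) • (((n : ℝ) + 1) • R ((n : ℝ) + 1) - 1)

theorem commute_yosida (hR : SubstochasticResolvent R) (m n : ℕ) :
    Commute (yosida R m) (yosida R n) := by
  have h := hR.commute (lam := (m : ℝ) + 1) (mu := (n : ℝ) + 1) (by positivity) (by positivity)
  refine (Commute.smul_left ?_ _).smul_right _
  exact (((h.smul_left _).smul_right _).sub_right (Commute.one_right _)).sub_left
    (Commute.one_left _)

theorem contractive_exp_yosida (hR : SubstochasticResolvent R) (n : ℕ) {t : ℝ} (ht : 0 ≤ t) :
    ContractiveOnCone (NormedSpace.exp (t • yosida R n)) := by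
  rw [yosida, smul_smul]
  exact (hR.contractive _ (by positivity)).exp_smul_sub_one (by positivity)

theorem tendsto_nat (hR : SubstochasticResolvent R) (x : X) :
    Tendsto (fun n : ℕ => ((n : ℝ) + 1) • R ((n : ℝ) + 1) x) atTop (𝓝 x) :=
  (hR.tendsto x).comp (tendsto_atTop_add_const_right _ 1 tendsto_natCast_atTop_atTop)

/-- By the resolvent identity, the approximant with parameter n + 1 sends R(1)y to (n + 1)R(n +
1)(R(1)y - y). -/
theorem tendsto_yosida (hR : SubstochasticResolvent R) (y : X) :
    Tendsto (fun n => yosida R n (R 1 y)) atTop (𝓝 (R 1 y - y)) := by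
  refine (hR.tendsto_nat (R 1 y - y)).congr fun n => ?_
  have hn : (0 : ℝ) < (n : ℝ) + 1 := by positivity
  have h1 := hR.identity ((n : ℝ) + 1) 1 hn one_pos y
  rw [yosida, _root_.smul_apply]
  congr 1
  rw [_root_.map_sub, _root_.sub_apply, _root_.smul_apply,
    one_apply_eq_self]
  rw [show (1 - ((n : ℝ) + 1)) • R ((n : ℝ) + 1) (R 1 y) = R ((n : ℝ) + 1) (R 1 y) -
    ((n : ℝ) + 1) • R ((n : ℝ) + 1) (R 1 y) by rw [sub_smul, one_smul]] at h1
  rw [sub_eq_sub_iff_add_eq_add] at h1 ⊢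
  rw [add_comm (R _ (R 1 y)), ← h1.symm.trans (add_comm _ _)]
  abel

/-- Every R(λ) has its range inside that of R(1), which therefore plays the role of the generator's
domain. -/
theorem range_eq (hR : SubstochasticResolvent R) {lam : ℝ} (hlam : 0 < lam) (x : X) :
    R lam x = R 1 (x + (1 - lam) • R lam x) := by
  have h1 := hR.identity 1 lam one_pos hlam x
  rw [_root_.map_add, map_smul, ← neg_sub lam 1, neg_smul, ← h1]
  abel

theorem dense_range (hR : SubstochasticResolvent R) : Dense (Set.range (R 1)) := fun x =>
  mem_closure_of_tendsto (hR.tendsto x) (by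
    filter_upwards [eventually_gt_atTop 0] with lam hlam
    rw [hR.range_eq hlam, ← map_smul]
    exact ⟨_, rfl⟩)

theorem exists_tendsto_exp (hR : SubstochasticResolvent R) (t : ℝ≥0) :
    ∃ S : X →L[ℝ] X, ∀ x,
      Tendsto (fun n => NormedSpace.exp ((t : ℝ) • yosida R n) x) atTop (𝓝 (S x)) := by
  have hc : ∀ x, CauchySeq fun n => NormedSpace.exp ((t : ℝ) • yosida R n) x := by
    refine cauchySeq_of_dense (M := coneConst X)
      (fun n => (hR.contractive_exp_yosida n t.coe_nonneg).norm_apply_le) hR.dense_range ?_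
    rintro _ ⟨y, rfl⟩
    have h1 := (hR.tendsto_yosida y).cauchySeq
    rw [Metric.cauchySeq_iff] at h1 ⊢
    intro ε hε
    set C := coneConst X * coneConst X * t + 1
    have hM := coneConst_pos X
    have hC : 0 < C := by positivity
    obtain ⟨N, hN⟩ := h1 (ε / C) (by positivity)
    refine ⟨N, fun m hm n hn => ?_⟩
    have h2 := hN m hm n hn
    rw [dist_eq_norm, lt_div_iff₀ hC] at h2
    rw [dist_eq_norm]
    refine (norm_exp_sub_exp_le (hR.commute_yosida n m) (fun s => hR.contractive_exp_yosida n)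
      (fun s => hR.contractive_exp_yosida m) t.coe_nonneg _).trans_lt ?_
    have : ∀ d : ℝ, d * C = coneConst X * (coneConst X * d) * t + d := fun d => by
      simp only [C]; ring
    rw [this] at h2
    linarith [norm_nonneg (yosida R m (R 1 y) - yosida R n (R 1 y))]
  choose f hf using fun x => cauchySeq_tendsto_of_complete (hc x)
  exact ⟨continuousLinearMapOfTendsto _ (tendsto_pi_nhds.2 hf), hf⟩

theorem exists_semigroup (hR : SubstochasticResolvent R) : ∃ V : C0Semigroup X,
    V.IsSubstochastic ∧ ∀ lam, 0 < lam → IsResolvent V.generator lam (R lam) := by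
  choose S hS using hR.exists_tendsto_exp
  have hc : ∀ t, ContractiveOnCone (S t) := fun t =>
    ContractiveOnCone.of_tendsto (fun n => hR.contractive_exp_yosida n t.coe_nonneg) (hS t)
  have h0 : S 0 = ContinuousLinearMap.id ℝ X := by
    ext x
    refine tendsto_nhds_unique (hS 0 x) ?_
    simp
  let V : C0Semigroup X :=
    { toFun := S
      map_zero := h0
      map_add := fun s t => by
        ext x
        have h1 : Tendsto (fun n => NormedSpace.exp ((s : ℝ) • yosida R n)
            (NormedSpace.exp ((t : ℝ) • yosida R n) x - S t x)) atTop (𝓝 0) := by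
          refine squeeze_zero_norm
            (fun n => (hR.contractive_exp_yosida n s.coe_nonneg).norm_apply_le _) ?_
          simpa using (tendsto_iff_norm_sub_tendsto_zero.1 (hS t x)).const_mul (coneConst X)
        have h2 := h1.add (hS s (S t x))
        rw [zero_add] at h2
        refine tendsto_nhds_unique (hS (s + t) x) (h2.congr fun n => ?_)
        rw [_root_.map_sub, sub_add_cancel, ← mul_apply_eq_comp,
          ← exp_add_eq_mul_of_commute (((Commute.refl _).smul_left _).smul_right _),
          ← add_smul, NNReal.coe_add]
      tendsto_zero := by
        refine tendsto_of_dense (L := ContinuousLinearMap.id ℝ X) (M := coneConst X)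
          (Eventually.of_forall fun t => (hc t).norm_apply_le) hR.dense_range ?_
        rintro _ ⟨y, rfl⟩
        rw [tendsto_iff_norm_sub_tendsto_zero]
        have h1 : Tendsto (fun t : ℝ≥0 => coneConst X * (coneConst X * ‖R 1 y - y‖) * (t : ℝ))
            (𝓝 0) (𝓝 0) := by
          refine Continuous.tendsto' (by fun_prop) _ _ (by simp)
        refine squeeze_zero (fun _ => norm_nonneg _) (fun t => ?_) h1
        refine le_of_tendsto_of_tendsto' ((hS t (R 1 y)).sub_const _).norm
          ((((hR.tendsto_yosida y).norm.const_mul _).const_mul _).mul_const _) fun n => ?_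
        have := norm_exp_sub_exp_le (a := 0) (Commute.zero_left (yosida R n))
          (fun s _ => by
            rw [smul_zero, NormedSpace.exp_zero]
            exact fun u hu => ⟨hu, le_rfl⟩)
          (fun s => hR.contractive_exp_yosida n) t.coe_nonneg (R 1 y)
        simpa using this }
  have hV : V.IsSubstochastic := hc
  -- Pass to the limit in the integrated equation for the approximating exponentials by dominated
  -- convergence, then divide by t. This identifies the generator on the range of R(1).
  have hg : ∀ y, (R 1 y, R 1 y - y) ∈ V.generator.graph := by
    intro y
    have h1 : ∀ t : ℝ≥0, V.toFun t (R 1 y) - R 1 y =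
        ∫ s in (0 : ℝ)..t, V.toFun s.toNNReal (R 1 y - y) := by
      intro t
      refine tendsto_nhds_unique ((hS t (R 1 y)).sub_const _) ?_
      simp only [exp_apply_sub_eq_integral]
      obtain ⟨C, hC⟩ := (hR.tendsto_yosida y).norm.bddAbove_range
      refine intervalIntegral.tendsto_integral_filter_of_dominated_convergence
        (fun _ => coneConst X * C) (Eventually.of_forall fun n => ?_)
        (Eventually.of_forall fun n => Eventually.of_forall fun s hs => ?_)
        intervalIntegrable_const (Eventually.of_forall fun s hs => ?_)
      · exact (continuous_exp_smul_apply (yosida R n) _).aestronglyMeasurable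
      · rw [Set.uIoc_of_le t.coe_nonneg] at hs
        exact ((hR.contractive_exp_yosida n hs.1.le).norm_apply_le _).trans
          (mul_le_mul_of_nonneg_left (hC ⟨n, rfl⟩) (coneConst_pos X).le)
      · rw [Set.uIoc_of_le t.coe_nonneg] at hs
        have h2 : Tendsto (fun n => NormedSpace.exp (s • yosida R n)
            (yosida R n (R 1 y) - (R 1 y - y))) atTop (𝓝 0) := by
          refine squeeze_zero_norm
            (fun n => (hR.contractive_exp_yosida n hs.1.le).norm_apply_le _) ?_
          simpa using
            (tendsto_iff_norm_sub_tendsto_zero.1 (hR.tendsto_yosida y)).const_mul (coneConst X)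
        have h3 := hS s.toNNReal (R 1 y - y)
        rw [Real.coe_toNNReal _ hs.1.le] at h3
        have h4 := h2.add h3
        rw [zero_add] at h4
        refine h4.congr fun n => ?_
        rw [_root_.map_sub (NormedSpace.exp (s • yosida R n)) (yosida R n (R 1 y)), sub_add_cancel]
    rw [C0Semigroup.mem_graph_generator]
    exact (hV.tendsto_integral_average (R 1 y - y)).congr fun t => by rw [h1]
  refine ⟨V, hV, fun lam hlam => ?_⟩
  obtain ⟨T, hT, -⟩ := hV.exists_isResolvent hlam
  have : T = R lam := by
    ext x
    have h1 := hg (x + (1 - lam) • R lam x)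
    rw [← hR.range_eq hlam] at h1
    rw [← hT.apply_graph h1]
    congr 1
    rw [sub_smul, one_smul]
    abel
  rwa [this] at hT

end SubstochasticResolvent

/-! ### Kato's resolvent series. -/

variable {A B : X →ₗ.[ℝ] X} {lam mu : ℝ}

theorem KatoConditions.isResolvent (hAB : KatoConditions A B) (hlam : 0 < lam) :
    IsResolvent A lam (resolventOp A lam) := by
  obtain ⟨U, hU, rfl⟩ := hAB.generates
  exact hU.isResolvent hlam

theorem KatoConditions.contractive_resolvent (hAB : KatoConditions A B) (hlam : 0 < lam) :
    ContractiveOnCone (lam • resolventOp A lam) := by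
  obtain ⟨U, hU, rfl⟩ := hAB.generates
  exact hU.contractive_resolvent hlam

theorem KatoConditions.tendsto_smul_resolvent (hAB : KatoConditions A B) (x : X) :
    Tendsto (fun lam => lam • resolventOp A lam x) atTop (𝓝 x) := by
  refine KatoHonesty.tendsto_smul_resolvent ?_ (fun lam => hAB.isResolvent)
    (fun lam => hAB.contractive_resolvent) x
  obtain ⟨U, hU, rfl⟩ := hAB.generates
  exact hU.dense_domain

theorem KatoConditions.resolvent_nonneg (hAB : KatoConditions A B) (hlam : 0 < lam) {u : X}
    (hu : 0 ≤ u) : 0 ≤ resolventOp A lam u := by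
  have := smul_nonneg (inv_nonneg.2 hlam.le) (hAB.contractive_resolvent hlam u hu).1
  rwa [_root_.smul_apply, inv_smul_smul₀ hlam.ne'] at this

/-- At x = R(λ,A)u one has Ax = λx - u, and Ψ is the norm on each of the positive vectors u, x and
Bx; the sign condition on Ψ(Ax + Bx) is then this estimate. -/
theorem KatoConditions.norm_val_resolvent_add_le (hAB : KatoConditions A B) (hlam : 0 < lam)
    {u : X} (hu : 0 ≤ u) :
    ‖val B (resolventOp A lam u)‖ + lam * ‖resolventOp A lam u‖ ≤ ‖u‖ := by
  have hR := hAB.isResolvent hlam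
  have h0 := hAB.resolvent_nonneg hlam hu
  have h1 := hAB.psi_le _ (hR.mem_domain u) h0
  rw [hR.val_apply, _root_.map_add, _root_.map_sub, map_smul, psi_of_nonneg hu, psi_of_nonneg h0,
    psi_of_nonneg (hAB.nonneg _ (hR.mem_domain u) h0), smul_eq_mul] at h1
  linarith

theorem KatoConditions.exists_katoStep (hAB : KatoConditions A B) (hlam : 0 < lam) :
    ∃ K : X →L[ℝ] X, ∀ w, K w = val B (resolventOp A lam w) := by
  have hB : ∀ w, resolventOp A lam w ∈ B.domain := fun w =>
    hAB.domain_le ((hAB.isResolvent hlam).mem_domain w)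
  refine exists_continuousLinearMap_of_cone
    { toFun := fun w => val B (resolventOp A lam w)
      map_add' := fun x y => by rw [_root_.map_add, val_add (hB x) (hB y)]
      map_smul' := fun c x => by rw [map_smul, val_smul c (hB x), RingHom.id_apply] }
    zero_le_one fun u hu => ?_
  have h1 := hAB.norm_val_resolvent_add_le hlam hu
  have h2 : 0 ≤ lam * ‖resolventOp A lam u‖ := by positivity
  simp only [LinearMap.coe_mk, AddHom.coe_mk]
  linarith

variable (A B lam) in
/-- The bounded operator `B R(lam, A)`. -/
noncomputable def katoStep : X →L[ℝ] X :=
  open Classical in if h : ∃ K : X →L[ℝ] X, ∀ w, K w = val B (resolventOp A lam w) then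
    Classical.choose h else 0

namespace KatoConditions

theorem katoStep_apply (hAB : KatoConditions A B) (hlam : 0 < lam) (w : X) :
    katoStep A B lam w = val B (resolventOp A lam w) := by
  have h := hAB.exists_katoStep hlam
  rw [katoStep, dif_pos h]
  exact Classical.choose_spec h w

theorem katoTerm_eq (hAB : KatoConditions A B) (hlam : 0 < lam) (k : ℕ) (u : X) :
    katoTerm A B lam k u = (resolventOp A lam * katoStep A B lam ^ k) u := by
  rw [katoTerm, mul_apply_eq_comp]
  congr 1
  induction k with
  | zero => rfl
  | succ k ih =>
    rw [Function.iterate_succ_apply', ih, pow_succ', mul_apply_eq_comp, hAB.katoStep_apply hlam]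

theorem norm_katoStep_add_le (hAB : KatoConditions A B) (hlam : 0 < lam) {u : X} (hu : 0 ≤ u) :
    ‖katoStep A B lam u‖ + lam * ‖resolventOp A lam u‖ ≤ ‖u‖ := by
  rw [hAB.katoStep_apply hlam]
  exact hAB.norm_val_resolvent_add_le hlam hu

theorem contractive_katoStep (hAB : KatoConditions A B) (hlam : 0 < lam) :
    ContractiveOnCone (katoStep A B lam) := fun u hu => by
  refine ⟨?_, ?_⟩
  · rw [hAB.katoStep_apply hlam]
    exact hAB.nonneg _ ((hAB.isResolvent hlam).mem_domain u) (hAB.resolvent_nonneg hlam hu)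
  · have h1 := hAB.norm_katoStep_add_le hlam hu
    have h2 : 0 ≤ lam * ‖resolventOp A lam u‖ := by positivity
    linarith

theorem katoTerm_nonneg (hAB : KatoConditions A B) (hlam : 0 < lam) (k : ℕ) {u : X} (hu : 0 ≤ u) :
    0 ≤ katoTerm A B lam k u := by
  rw [hAB.katoTerm_eq hlam]
  exact hAB.resolvent_nonneg hlam ((hAB.contractive_katoStep hlam).pow k u hu).1

theorem katoTerm_succ (k : ℕ) (u : X) :
    katoTerm A B lam (k + 1) u = resolventOp A lam (val B (katoTerm A B lam k u)) := by
  rw [katoTerm, Function.iterate_succ_apply', katoTerm]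

theorem katoTerm_katoStep (hAB : KatoConditions A B) (hlam : 0 < lam) (k : ℕ) (u : X) :
    katoTerm A B lam k (katoStep A B lam u) = katoTerm A B lam (k + 1) u := by
  rw [hAB.katoTerm_eq hlam, hAB.katoTerm_eq hlam, pow_succ, ← mul_assoc]
  rfl

theorem katoTerm_mem_domain (hAB : KatoConditions A B) (hlam : 0 < lam) (k : ℕ) (u : X) :
    katoTerm A B lam k u ∈ A.domain := (hAB.isResolvent hlam).mem_domain _

/-- The one-step estimate summed along the iterates. The remainder ‖Kⁿu‖ is kept because it later
dominates the loss functional. -/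
theorem sum_norm_katoTerm_le (hAB : KatoConditions A B) (hlam : 0 < lam) {u : X} (hu : 0 ≤ u)
    (n : ℕ) : ‖(katoStep A B lam ^ n) u‖ + lam * ∑ k ∈ Finset.range n, ‖katoTerm A B lam k u‖ ≤
      ‖u‖ := by
  induction n with
  | zero => simp
  | succ n ih =>
    have h := hAB.norm_katoStep_add_le hlam ((hAB.contractive_katoStep hlam).pow n u hu).1
    rw [Finset.sum_range_succ, pow_succ', mul_apply_eq_comp, hAB.katoTerm_eq hlam n,
      mul_apply_eq_comp]
    linarith

theorem summable_norm_katoTerm_and_le (hAB : KatoConditions A B) (hlam : 0 < lam) {u : X}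
    (hu : 0 ≤ u) : (Summable fun k => ‖katoTerm A B lam k u‖) ∧
      ∑' k, ‖katoTerm A B lam k u‖ ≤ lam⁻¹ * ‖u‖ := by
  have h : ∀ n, ∑ k ∈ Finset.range n, ‖katoTerm A B lam k u‖ ≤ lam⁻¹ * ‖u‖ := fun n => by
    rw [le_inv_mul_iff₀ hlam]
    linarith [hAB.sum_norm_katoTerm_le hlam hu n, norm_nonneg ((katoStep A B lam ^ n) u)]
  exact ⟨summable_of_sum_range_le (fun _ => norm_nonneg _) h,
    Real.tsum_le_of_sum_range_le (fun _ => norm_nonneg _) h⟩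

theorem summable_katoTerm (hAB : KatoConditions A B) (hlam : 0 < lam) (x : X) :
    Summable fun k => katoTerm A B lam k x := by
  obtain ⟨u, v, hu, hv, rfl⟩ := AbstractStateSpace.generating x
  simp only [hAB.katoTerm_eq hlam, _root_.map_sub]
  simp only [← hAB.katoTerm_eq hlam]
  exact (hAB.summable_norm_katoTerm_and_le hlam hu).1.of_norm.sub
    (hAB.summable_norm_katoTerm_and_le hlam hv).1.of_norm

theorem exists_hasSum_katoTerm (hAB : KatoConditions A B) (hlam : 0 < lam) :
    ∃ S : X →L[ℝ] X, ∀ u, HasSum (fun k => katoTerm A B lam k u) (S u) := by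
  have hs := hAB.summable_katoTerm hlam
  obtain ⟨S, hS⟩ := exists_continuousLinearMap_of_cone
    { toFun := fun u => ∑' k, katoTerm A B lam k u
      map_add' := fun x y => by
        rw [← (hs x).tsum_add (hs y)]
        simp only [hAB.katoTerm_eq hlam, _root_.map_add]
      map_smul' := fun c x => by
        rw [RingHom.id_apply, ← (hs x).tsum_const_smul]
        simp only [hAB.katoTerm_eq hlam, map_smul] }
    (inv_nonneg.2 hlam.le) fun u hu => by
      have h1 := hAB.summable_norm_katoTerm_and_le hlam hu
      exact (norm_tsum_le_tsum_norm h1.1).trans h1.2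
  exact ⟨S, fun u => by rw [hS]; exact (hs u).hasSum⟩

end KatoConditions

variable (A B lam) in
/-- The sum of Kato's resolvent series. -/
noncomputable def katoResolvent : X →L[ℝ] X :=
  open Classical in if h : ∃ S : X →L[ℝ] X, ∀ u, HasSum (fun k => katoTerm A B lam k u) (S u) then
    Classical.choose h else 0

namespace KatoConditions

theorem hasSum_katoTerm (hAB : KatoConditions A B) (hlam : 0 < lam) (u : X) :
    HasSum (fun k => katoTerm A B lam k u) (katoResolvent A B lam u) := by
  have h := hAB.exists_hasSum_katoTerm hlam
  rw [katoResolvent, dif_pos h]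
  exact Classical.choose_spec h u

theorem katoResolvent_nonneg (hAB : KatoConditions A B) (hlam : 0 < lam) {u : X} (hu : 0 ≤ u) :
    0 ≤ katoResolvent A B lam u :=
  (hAB.hasSum_katoTerm hlam u).nonneg fun k => hAB.katoTerm_nonneg hlam k hu

theorem contractive_katoResolvent (hAB : KatoConditions A B) (hlam : 0 < lam) :
    ContractiveOnCone (lam • katoResolvent A B lam) := fun u hu => by
  refine ⟨smul_nonneg hlam.le (hAB.katoResolvent_nonneg hlam hu), ?_⟩
  have h1 := hAB.summable_norm_katoTerm_and_le hlam hu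
  rw [_root_.smul_apply, norm_smul, Real.norm_of_nonneg hlam.le, ← le_inv_mul_iff₀ hlam,
    ← (hAB.hasSum_katoTerm hlam u).tsum_eq]
  exact (norm_tsum_le_tsum_norm h1.1).trans h1.2

/-- Feeding K u into the series shifts it by one place, so only the zeroth term remains. This is why
the generator extends A + B. -/
theorem katoResolvent_sub_katoStep (hAB : KatoConditions A B) (hlam : 0 < lam) (u : X) :
    katoResolvent A B lam (u - katoStep A B lam u) = resolventOp A lam u := by
  have h1 := hAB.hasSum_katoTerm hlam (katoStep A B lam u)
  simp only [hAB.katoTerm_katoStep hlam] at h1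
  have h2 := (hasSum_nat_add_iff' 1).2 (hAB.hasSum_katoTerm hlam u)
  rw [_root_.map_sub, h1.unique h2, Finset.sum_range_one, sub_sub_cancel]
  rfl

theorem katoResolvent_apply_sub (hAB : KatoConditions A B) (hlam : 0 < lam) {x : X}
    (hx : x ∈ A.domain) : katoResolvent A B lam (lam • x - (val A x + val B x)) = x := by
  have h1 := (hAB.isResolvent hlam).apply_graph (mk_val_mem_graph hx)
  have h2 := hAB.katoResolvent_sub_katoStep hlam (lam • x - val A x)
  rwa [hAB.katoStep_apply hlam, h1, sub_sub] at h2

theorem resolvent_le_katoResolvent (hAB : KatoConditions A B) (hlam : 0 < lam) {u : X}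
    (hu : 0 ≤ u) : resolventOp A lam u ≤ katoResolvent A B lam u :=
  le_hasSum (hAB.hasSum_katoTerm hlam u) 0 fun k _ => hAB.katoTerm_nonneg hlam k hu

/-- For u ≥ 0, λR(λ,A)u lies below λS(λ)u, so by additivity the norm of the difference is the
difference of norms, at most ‖u‖ - ‖λR(λ,A)u‖, which tends to 0. -/
theorem tendsto_smul_katoResolvent (hAB : KatoConditions A B) (x : X) :
    Tendsto (fun lam => lam • katoResolvent A B lam x) atTop (𝓝 x) := by
  have key : ∀ u : X, 0 ≤ u → Tendsto (fun lam => lam • katoResolvent A B lam u) atTop (𝓝 u) := by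
    intro u hu
    have h1 := hAB.tendsto_smul_resolvent u
    have h2 : Tendsto (fun lam => lam • katoResolvent A B lam u - lam • resolventOp A lam u) atTop
        (𝓝 0) := by
      have h3 := h1.norm.const_sub ‖u‖
      rw [sub_self] at h3
      refine squeeze_zero_norm' ?_ h3
      filter_upwards [eventually_gt_atTop 0] with lam hlam
      have h4 := (hAB.contractive_resolvent hlam u hu).1
      rw [_root_.smul_apply] at h4
      rw [norm_sub_of_le h4
        (smul_le_smul_of_nonneg_left (hAB.resolvent_le_katoResolvent hlam hu) hlam.le)]
      exact sub_le_sub_right (hAB.contractive_katoResolvent hlam u hu).2 _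
    simpa using h2.add h1
  obtain ⟨u, v, hu, hv, rfl⟩ := AbstractStateSpace.generating x
  simpa only [_root_.map_sub, smul_sub] using (key u hu).sub (key v hv)

/-- The resolvent identity graded by the number of factors B; summing over n turns the right side
into the product of the two series. -/
theorem katoTerm_sub_katoTerm (hAB : KatoConditions A B) (hlam : 0 < lam) (hmu : 0 < mu) (n : ℕ)
    (u : X) : katoTerm A B lam n u - katoTerm A B mu n u =
      (mu - lam) • ∑ p ∈ Finset.HasAntidiagonal.antidiagonal n,
        katoTerm A B lam p.1 (katoTerm A B mu p.2 u) := by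
  have hid := (hAB.isResolvent hlam).resolvent_identity (hAB.isResolvent hmu)
  induction n with
  | zero => simpa [katoTerm] using hid u
  | succ n ih =>
    set w := (mu - lam) • ∑ p ∈ Finset.HasAntidiagonal.antidiagonal n,
      (katoStep A B lam ^ p.1) (katoTerm A B mu p.2 u) with hw
    have h1 : katoTerm A B lam n u - katoTerm A B mu n u = resolventOp A lam w := by
      rw [ih, hw, map_smul, _root_.map_sum]
      simp only [hAB.katoTerm_eq hlam, mul_apply_eq_comp]
    have h2 : val B (katoTerm A B lam n u) = val B (katoTerm A B mu n u) + katoStep A B lam w := by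
      rw [hAB.katoStep_apply hlam, ← h1, ← val_add
        (hAB.domain_le (hAB.katoTerm_mem_domain hmu n u)), add_sub_cancel]
      rw [h1]
      exact hAB.domain_le ((hAB.isResolvent hlam).mem_domain w)
    have h3 := hid (val B (katoTerm A B mu n u))
    rw [← katoTerm_succ] at h3
    rw [Finset.Nat.sum_antidiagonal_succ, katoTerm_succ n u, h2, _root_.map_add, smul_add,
      add_sub_right_comm, h3]
    congr 1
    rw [hw, map_smul, map_smul, _root_.map_sum, _root_.map_sum]
    simp only [hAB.katoTerm_eq hlam, mul_apply_eq_comp, pow_succ']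

theorem summable_katoTerm_katoTerm (hAB : KatoConditions A B) (hlam : 0 < lam) (hmu : 0 < mu)
    (x : X) : Summable fun p : ℕ × ℕ => katoTerm A B lam p.2 (katoTerm A B mu p.1 x) := by
  have key : ∀ u : X, 0 ≤ u →
      Summable fun p : ℕ × ℕ => katoTerm A B lam p.2 (katoTerm A B mu p.1 u) := by
    intro u hu
    refine Summable.of_norm ((summable_prod_of_nonneg fun _ => norm_nonneg _).2 ⟨fun k => ?_, ?_⟩)
    · exact (hAB.summable_norm_katoTerm_and_le hlam (hAB.katoTerm_nonneg hmu k hu)).1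
    · refine ((hAB.summable_norm_katoTerm_and_le hmu hu).1.mul_left lam⁻¹).of_nonneg_of_le
        (fun _ => tsum_nonneg fun _ => norm_nonneg _) fun k => ?_
      exact (hAB.summable_norm_katoTerm_and_le hlam (hAB.katoTerm_nonneg hmu k hu)).2
  obtain ⟨u, v, hu, hv, rfl⟩ := AbstractStateSpace.generating x
  have h := (key u hu).sub (key v hv)
  simpa only [hAB.katoTerm_eq hlam, hAB.katoTerm_eq hmu, ← _root_.map_sub] using h

theorem katoResolvent_identity (hAB : KatoConditions A B) (hlam : 0 < lam) (hmu : 0 < mu) (x : X) :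
    katoResolvent A B lam x - katoResolvent A B mu x =
      (mu - lam) • katoResolvent A B lam (katoResolvent A B mu x) := by
  have h1 := (hAB.hasSum_katoTerm hlam x).sub (hAB.hasSum_katoTerm hmu x)
  simp only [hAB.katoTerm_sub_katoTerm hlam hmu] at h1
  refine h1.unique (HasSum.const_smul _ ?_)
  have hs := hAB.summable_katoTerm_katoTerm hlam hmu x
  have h2 : HasSum (fun p : ℕ × ℕ => katoTerm A B lam p.2 (katoTerm A B mu p.1 x))
      (katoResolvent A B lam (katoResolvent A B mu x)) := by
    have h3 := hs.hasSum.prod_fiberwise fun k => hAB.hasSum_katoTerm hlam (katoTerm A B mu k x)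
    rw [← h3.unique ((hAB.hasSum_katoTerm hmu x).mapL (katoResolvent A B lam))]
    exact hs.hasSum
  -- The double sum was indexed with the μ-index first, hence the swap before regrouping along
  -- antidiagonals.
  have h4 := (Finset.HasAntidiagonal.sigmaAntidiagonalEquivProd (A := ℕ)).hasSum_iff.2
    ((Equiv.prodComm ℕ ℕ).hasSum_iff.2 h2)
  exact h4.sigma fun n => by
    rw [← Finset.sum_coe_sort]
    exact hasSum_fintype _

/-! ### Existence and uniqueness of the Kato semigroup. -/

theorem substochasticResolvent (hAB : KatoConditions A B) :
    SubstochasticResolvent fun lam => katoResolvent A B lam where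
  contractive _ hlam := hAB.contractive_katoResolvent hlam
  identity _ _ hlam hmu := hAB.katoResolvent_identity hlam hmu
  tendsto := hAB.tendsto_smul_katoResolvent

theorem mem_graph_add_iff (hAB : KatoConditions A B) {x y : X} :
    (x, y) ∈ (A + B).graph ↔ x ∈ A.domain ∧ y = val A x + val B x := by
  rw [LinearPMap.mem_graph_iff]
  constructor
  · rintro ⟨z, rfl, rfl⟩
    refine ⟨z.2.1, ?_⟩
    rw [val_eq_of_mem_graph (A.mem_graph ⟨z, z.2.1⟩), val_eq_of_mem_graph (B.mem_graph ⟨z, z.2.2⟩)]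
    rfl
  · rintro ⟨hx, rfl⟩
    refine ⟨⟨x, hx, hAB.domain_le hx⟩, rfl, ?_⟩
    rw [val_eq_of_mem_graph (A.mem_graph ⟨x, hx⟩),
      val_eq_of_mem_graph (B.mem_graph ⟨x, hAB.domain_le hx⟩)]
    rfl

theorem add_le_iff (hAB : KatoConditions A B) {G : X →ₗ.[ℝ] X} :
    A + B ≤ G ↔ ∀ x ∈ A.domain, (x, val A x + val B x) ∈ G.graph := by
  constructor
  · intro h x hx
    exact LinearPMap.le_graph_of_le h (hAB.mem_graph_add_iff.2 ⟨hx, rfl⟩)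
  · intro h
    refine LinearPMap.le_of_le_graph ?_
    rintro ⟨x, y⟩ hxy
    obtain ⟨hx, rfl⟩ := hAB.mem_graph_add_iff.1 hxy
    exact h x hx

theorem existsUnique_isKatoSemigroup (hAB : KatoConditions A B) :
    ∃! V : C0Semigroup X, IsKatoSemigroup A B V := by
  obtain ⟨V, hV, hR⟩ := hAB.substochasticResolvent.exists_semigroup
  refine ⟨V, ⟨hV, hAB.add_le_iff.2 fun x hx => ?_, fun lam hlam u => ?_⟩, fun W hW => ?_⟩
  · exact (hR 1 one_pos).mem_graph_iff.2 (hAB.katoResolvent_apply_sub one_pos hx)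
  · rw [(hR lam hlam).resolventOp_eq]
    exact hAB.hasSum_katoTerm hlam u
  · refine hW.substochastic.eq_of_generator_eq hV ?_
    have h1 := hW.substochastic.isResolvent one_pos
    have h2 : resolventOp W.generator 1 = katoResolvent A B 1 :=
      ContinuousLinearMap.ext fun u =>
        (hW.resolvent_eq 1 one_pos u).unique (hAB.hasSum_katoTerm one_pos u)
    rw [h2] at h1
    exact h1.eq (hR 1 one_pos)

end KatoConditions

theorem IsKatoSemigroup.isResolvent (hAB : KatoConditions A B) {V : C0Semigroup X}
    (hV : IsKatoSemigroup A B V) (hlam : 0 < lam) :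
    IsResolvent V.generator lam (katoResolvent A B lam) := by
  have h2 : resolventOp V.generator lam = katoResolvent A B lam :=
    ContinuousLinearMap.ext fun u =>
      (hV.resolvent_eq lam hlam u).unique (hAB.hasSum_katoTerm hlam u)
  rw [← h2]
  exact hV.substochastic.isResolvent hlam

/-! ### The loss functional and honesty. -/

/-- `ell` is the functional `u ↦ lim ⟨Ψ, (B R(lam, A))^n u⟩`. -/
def IsLossFunctional (A B : X →ₗ.[ℝ] X) (lam : ℝ) (ell : X →L[ℝ] ℝ) : Prop :=
  ∀ u, Tendsto (fun n => psi X ((katoStep A B lam ^ n) u)) atTop (𝓝 (ell u))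

namespace KatoConditions

theorem antitone_norm_katoStep_pow (hAB : KatoConditions A B) (hlam : 0 < lam) {u : X}
    (hu : 0 ≤ u) : Antitone fun n => ‖(katoStep A B lam ^ n) u‖ :=
  antitone_nat_of_succ_le fun n => by
    rw [pow_succ', mul_apply_eq_comp]
    exact (hAB.contractive_katoStep hlam _
      ((hAB.contractive_katoStep hlam).pow n u hu).1).2

theorem psi_katoStep_pow (hAB : KatoConditions A B) (hlam : 0 < lam) {u : X} (hu : 0 ≤ u) (n : ℕ) :
    psi X ((katoStep A B lam ^ n) u) = ‖(katoStep A B lam ^ n) u‖ :=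
  psi_of_nonneg ((hAB.contractive_katoStep hlam).pow n u hu).1

theorem exists_isLossFunctional (hAB : KatoConditions A B) (hlam : 0 < lam) :
    ∃ ell : X →L[ℝ] ℝ, IsLossFunctional A B lam ell := by
  have h1 : ∀ x, ∃ l, Tendsto (fun n => psi X ((katoStep A B lam ^ n) x)) atTop (𝓝 l) := by
    have key : ∀ u : X, 0 ≤ u →
        ∃ l, Tendsto (fun n => psi X ((katoStep A B lam ^ n) u)) atTop (𝓝 l) := fun u hu => by
      simp only [hAB.psi_katoStep_pow hlam hu]
      exact ⟨_, tendsto_atTop_ciInf (hAB.antitone_norm_katoStep_pow hlam hu)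
        ⟨0, by rintro _ ⟨n, rfl⟩; exact norm_nonneg _⟩⟩
    intro x
    obtain ⟨u, v, hu, hv, rfl⟩ := AbstractStateSpace.generating x
    obtain ⟨a, ha⟩ := key u hu
    obtain ⟨b, hb⟩ := key v hv
    exact ⟨a - b, by simpa only [_root_.map_sub] using ha.sub hb⟩
  choose f hf using h1
  let g : ℕ → X →L[ℝ] ℝ := fun n => (⟨psi X, continuous_psi X⟩ : X →L[ℝ] ℝ) ∘L katoStep A B lam ^ n
  exact ⟨continuousLinearMapOfTendsto g (f := f) (tendsto_pi_nhds.2 hf), hf⟩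

variable {ell : X →L[ℝ] ℝ}

theorem _root_.KatoHonesty.IsLossFunctional.apply_katoStep (h : IsLossFunctional A B lam ell)
    (u : X) : ell (katoStep A B lam u) = ell u := by
  refine tendsto_nhds_unique (h (katoStep A B lam u))
    (((h u).comp (tendsto_add_atTop_nat 1)).congr fun n => ?_)
  rw [Function.comp, pow_succ, mul_apply_eq_comp]

/-- A telescoping sum. On the cone its terms are nonnegative, which upgrades convergence of partial
sums to the unconditional summability required here. -/
theorem hasSum_psi_sub (hAB : KatoConditions A B) (hlam : 0 < lam)
    (hell : IsLossFunctional A B lam ell) (x : X) :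
    HasSum (fun n => psi X ((katoStep A B lam ^ n) x) - psi X ((katoStep A B lam ^ (n + 1)) x))
      (psi X x - ell x) := by
  have key : ∀ u : X, 0 ≤ u →
      HasSum (fun n => psi X ((katoStep A B lam ^ n) u) - psi X ((katoStep A B lam ^ (n + 1)) u))
        (psi X u - ell u) := fun u hu => by
    rw [hasSum_iff_tendsto_nat_of_nonneg]
    · simpa only [Finset.sum_range_sub', pow_zero, one_apply_eq_self] using
        (hell u).const_sub (psi X u)
    · intro n
      rw [hAB.psi_katoStep_pow hlam hu, hAB.psi_katoStep_pow hlam hu]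
      exact sub_nonneg.2 (hAB.antitone_norm_katoStep_pow hlam hu n.le_succ)
  obtain ⟨u, v, hu, hv, rfl⟩ := AbstractStateSpace.generating x
  have h := (key u hu).sub (key v hv)
  simp only [_root_.map_sub]
  rw [sub_sub_sub_comm]
  refine (congrArg (fun f => HasSum f _) (funext fun n => ?_)).mpr h
  exact sub_sub_sub_comm _ _ _ _

/-- With u = λx - Gx, the k-th term of ā(x) is -λΨ(R Kᵏu) + Ψ(Kᵏu) - Ψ(Kᵏ⁺¹u). The sum is -λΨ(x) +
Ψ(u) - ell(u), that is, a₀(x) - ell(u). -/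
theorem aZero_sub_aBar (hAB : KatoConditions A B) {V : C0Semigroup X}
    (hV : IsKatoSemigroup A B V) (hlam : 0 < lam) (hell : IsLossFunctional A B lam ell) {x : X}
    (hx : x ∈ V.generator.domain) :
    aZero V.generator x - aBar A B V.generator lam x = ell (lam • x - val V.generator x) := by
  set u := lam • x - val V.generator x with hu
  have hR := hV.isResolvent hAB hlam
  have hSu : katoResolvent A B lam u = x := hR.apply_graph (mk_val_mem_graph hx)
  have h1 := ((hAB.hasSum_katoTerm hlam u).mapL (⟨psi X, continuous_psi X⟩ : X →L[ℝ] ℝ)).mul_left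
    (-lam)
  have h2 := h1.add (hAB.hasSum_psi_sub hlam hell u)
  have h3 : ∀ k, val A (katoTerm A B lam k u) + val B (katoTerm A B lam k u) =
      lam • katoTerm A B lam k u - (katoStep A B lam ^ k) u + (katoStep A B lam ^ (k + 1)) u := by
    intro k
    rw [hAB.katoTerm_eq hlam, mul_apply_eq_comp, (hAB.isResolvent hlam).val_apply,
      ← hAB.katoStep_apply hlam, pow_succ', mul_apply_eq_comp]
  have h4 : aBar A B V.generator lam x = -lam * psi X x + (psi X u - ell u) := by
    rw [hSu] at h2
    refine Eq.trans (tsum_congr fun k => ?_) h2.tsum_eq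
    rw [← hu, h3, _root_.map_add, _root_.map_sub, map_smul, smul_eq_mul]
    change _ = -lam * psi X (katoTerm A B lam k u) + _
    ring
  rw [h4, aZero]
  have h5 : psi X u = lam * psi X x - psi X (val V.generator x) := by
    rw [hu, _root_.map_sub, map_smul, smul_eq_mul]
  linarith

theorem isHonest_iff (hAB : KatoConditions A B) {V : C0Semigroup X}
    (hV : IsKatoSemigroup A B V) (hlam : 0 < lam) (hell : IsLossFunctional A B lam ell) :
    IsHonest A B V lam ↔ ell = 0 := by
  have hs := hV.substochastic
  have hR := hV.isResolvent hAB hlam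
  have key : ∀ (t : ℝ≥0) (u : X), 0 ≤ u → ((‖V.toFun t u‖ - ‖u‖ =
      -aBar A B V.generator lam (∫ s in (0 : ℝ)..t, V.toFun s.toNNReal u)) ↔
      ell (lam • (∫ s in (0 : ℝ)..t, V.toFun s.toNNReal u) - (V.toFun t u - u)) = 0) := by
    intro t u hu
    have hg := hs.integral_mem_graph t u
    have h1 := hAB.aZero_sub_aBar hV hlam hell (mem_domain_of_mem_graph hg)
    rw [aZero, val_eq_of_mem_graph hg] at h1
    rw [← h1, _root_.map_sub, psi_of_nonneg hu, psi_of_nonneg (hs t u hu).1]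
    constructor <;> intro h <;> linarith
  constructor
  · intro h
    -- Divide the honesty identity by t and let t → 0; taking u = S(λ)w afterwards makes the
    -- argument of `ell` equal to w.
    have h1 : ∀ u : X, 0 ≤ u → u ∈ V.generator.domain →
        ell (lam • u - val V.generator u) = 0 := by
      intro u hu hu'
      have h2 := (C0Semigroup.mem_graph_generator _ _).1 (mk_val_mem_graph hu')
      have h3 := ((hs.tendsto_integral_average u).const_smul lam).sub h2
      refine tendsto_nhds_unique ((ell.continuous.tendsto _).comp h3)
        (tendsto_const_nhds.congr fun t => ?_)
      simp only [Function.comp]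
      rw [smul_comm lam, ← smul_sub, map_smul, (key t u hu).1 (h t u hu), smul_zero]
    have h4 : (ell : X →ₗ[ℝ] ℝ) = 0 := eq_of_eq_on_cone fun w hw => by
      have h5 := h1 _ (hAB.katoResolvent_nonneg hlam hw) (hR.mem_domain w)
      rw [hR.val_apply, sub_sub_cancel] at h5
      simpa using h5
    ext w
    exact LinearMap.congr_fun h4 w
  · rintro rfl t u hu
    exact (key t u hu).2 (by simp)

/-- Since W's generator extends A + B, its resolvent S satisfies S(w - K w) = R(λ,A)w. The partial
sums of Kato's series thus telescope, with remainder S Kⁿu. -/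
theorem eq_of_loss_eq_zero (hAB : KatoConditions A B) {V W : C0Semigroup X}
    (hV : IsKatoSemigroup A B V) (hlam : 0 < lam)
    (hell : IsLossFunctional A B lam (0 : X →L[ℝ] ℝ)) (hW : W.IsSubstochastic)
    (hext : A + B ≤ W.generator) : W = V := by
  refine hW.eq_of_generator_eq hV.substochastic ?_
  have hR := hV.isResolvent hAB hlam
  obtain ⟨S, hS, hSc⟩ := hW.exists_isResolvent hlam
  have h1 : ∀ (u : X) (n : ℕ), ∑ k ∈ Finset.range n, katoTerm A B lam k u =
      S u - S ((katoStep A B lam ^ n) u) := by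
    intro u n
    induction n with
    | zero => simp
    | succ n ih =>
      have h2 := hS.apply_graph
        (hAB.add_le_iff.1 hext _ ((hAB.isResolvent hlam).mem_domain ((katoStep A B lam ^ n) u)))
      rw [(hAB.isResolvent hlam).val_apply, ← hAB.katoStep_apply hlam, ← sub_sub, sub_sub_cancel,
        _root_.map_sub] at h2
      rw [Finset.sum_range_succ, ih, hAB.katoTerm_eq hlam, mul_apply_eq_comp, ← h2, pow_succ',
        mul_apply_eq_comp]
      abel
  have h5 : (katoResolvent A B lam : X →ₗ[ℝ] X) = S := eq_of_eq_on_cone fun u hu => by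
    refine tendsto_nhds_unique (hAB.hasSum_katoTerm hlam u).tendsto_sum_nat ?_
    -- On the cone Ψ is the norm, so zero loss means norm convergence.
    have h3 : Tendsto (fun n => (katoStep A B lam ^ n) u) atTop (𝓝 0) := by
      rw [tendsto_zero_iff_norm_tendsto_zero]
      simpa only [hAB.psi_katoStep_pow hlam hu, _root_.zero_apply] using hell u
    simp only [h1]
    have h4 := ((S.continuous.tendsto 0).comp h3).const_sub (S u)
    rwa [_root_.map_zero, sub_zero] at h4
  have h6 : katoResolvent A B lam = S := ContinuousLinearMap.ext fun u => LinearMap.congr_fun h5 u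
  rw [h6] at hR
  exact hS.eq hR

end KatoConditions

variable {ell : X →L[ℝ] ℝ}

namespace KatoConditions

/-- With v = (λ - A)x the argument of `ell` is v - K v, and `ell` is invariant under K. -/
theorem loss_apply_domain (hAB : KatoConditions A B) (hlam : 0 < lam)
    (hell : IsLossFunctional A B lam ell) {x : X} (hx : x ∈ A.domain) :
    ell (lam • x - (val A x + val B x)) = 0 := by
  have h1 := (hAB.isResolvent hlam).apply_graph (mk_val_mem_graph hx)
  have h2 := hell.apply_katoStep (lam • x - val A x)
  rw [hAB.katoStep_apply hlam, h1] at h2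
  rw [← sub_sub, _root_.map_sub, h2, sub_self]

theorem tendsto_katoResolvent_katoStep_pow (hAB : KatoConditions A B) (hmu : 0 < mu) (u : X) :
    Tendsto (fun n => katoResolvent A B mu ((katoStep A B mu ^ n) u)) atTop (𝓝 0) := by
  have h1 := (hAB.hasSum_katoTerm hmu u).tendsto_sum_nat.const_sub (katoResolvent A B mu u)
  rw [sub_self] at h1
  refine h1.congr fun n => ?_
  induction n with
  | zero => simp
  | succ n ih =>
    have h2 := hAB.katoResolvent_sub_katoStep hmu ((katoStep A B mu ^ n) u)
    rw [_root_.map_sub, ← ih] at h2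
    rw [Finset.sum_range_succ, hAB.katoTerm_eq hmu n, mul_apply_eq_comp, ← h2, pow_succ',
      mul_apply_eq_comp]
    abel

/-- Here `ell` belongs to the fixed λ while μ varies. The functional is the limit of ell(K_μⁿu),
with K_μ = B R(μ,A), and each ell(K_μⁿu) lies between 0 and ‖K_μⁿu‖, which the summed estimate at μ
controls. -/
theorem loss_katoResolvent_mem (hAB : KatoConditions A B) (hlam : 0 < lam)
    (hell : IsLossFunctional A B lam ell) (hmu : 0 < mu) {u : X} (hu : 0 ≤ u) :
    0 ≤ ell (lam • katoResolvent A B mu u - (mu • katoResolvent A B mu u - u)) ∧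
      ell (lam • katoResolvent A B mu u - (mu • katoResolvent A B mu u - u)) ≤
        ‖u‖ - mu * ‖katoResolvent A B mu u‖ := by
  -- The functional does not see w - K_μ w: its image under S(μ) is R(μ,A)w, which lies in D(A),
  -- where ell ∘ (λ - G) vanishes.
  have h1 : ∀ w, ell (lam • katoResolvent A B mu (katoStep A B mu w) -
      (mu • katoResolvent A B mu (katoStep A B mu w) - katoStep A B mu w)) =
      ell (lam • katoResolvent A B mu w - (mu • katoResolvent A B mu w - w)) := by
    intro w
    have h2 := hAB.loss_apply_domain hlam hell ((hAB.isResolvent hmu).mem_domain w)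
    rw [(hAB.isResolvent hmu).val_apply, ← hAB.katoStep_apply hmu,
      ← hAB.katoResolvent_sub_katoStep hmu] at h2
    rw [← sub_eq_zero, ← neg_eq_zero, ← h2, ← _root_.map_sub, ← _root_.map_neg,
      _root_.map_sub (katoResolvent A B mu), smul_sub, smul_sub]
    congr 1
    abel
  have h2 : ∀ n, ell (lam • katoResolvent A B mu ((katoStep A B mu ^ n) u) -
      (mu • katoResolvent A B mu ((katoStep A B mu ^ n) u) - (katoStep A B mu ^ n) u)) =
      ell (lam • katoResolvent A B mu u - (mu • katoResolvent A B mu u - u)) := by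
    intro n
    induction n with
    | zero => simp
    | succ n ih => rw [pow_succ', mul_apply_eq_comp, h1, ih]
  have h3 : Tendsto (fun n => ell ((katoStep A B mu ^ n) u)) atTop
      (𝓝 (ell (lam • katoResolvent A B mu u - (mu • katoResolvent A B mu u - u)))) := by
    have h4 := hAB.tendsto_katoResolvent_katoStep_pow hmu u
    have h5 := (ell.continuous.tendsto _).comp ((h4.const_smul lam).sub (h4.const_smul mu))
    rw [smul_zero, smul_zero, sub_zero, _root_.map_zero] at h5
    have h6 := h5.const_sub (ell (lam • katoResolvent A B mu u - (mu • katoResolvent A B mu u - u)))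
    rw [sub_zero] at h6
    refine h6.congr fun n => ?_
    rw [← h2 n, Function.comp, ← _root_.map_sub]
    congr 1
    abel
  have h7 : ∀ v : X, 0 ≤ v → 0 ≤ ell v ∧ ell v ≤ ‖v‖ := fun v hv => by
    refine ⟨ge_of_tendsto' (hell v) fun n => ?_, le_of_tendsto' (hell v) fun n => ?_⟩
    · rw [hAB.psi_katoStep_pow hlam hv]
      exact norm_nonneg _
    · rw [hAB.psi_katoStep_pow hlam hv]
      exact ((hAB.contractive_katoStep hlam).pow n v hv).2
  have h8 := fun n => h7 _ ((hAB.contractive_katoStep hmu).pow n u hu).1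
  refine ⟨ge_of_tendsto' h3 fun n => (h8 n).1, ?_⟩
  refine le_of_tendsto_of_tendsto' h3
    (((hAB.hasSum_katoTerm hmu u).tendsto_sum_nat.norm.const_mul mu).const_sub ‖u‖) fun n => ?_
  have h9 := hAB.sum_norm_katoTerm_le hmu hu n
  have h10 := mul_le_mul_of_nonneg_left
    (norm_sum_le (Finset.range n) fun k => katoTerm A B mu k u) hmu.le
  linarith [(h8 n).2]

end KatoConditions

/-! ### Rank-one perturbations of the Kato generator. -/

/-- The operator `u ↦ G u + ⟨ell, (lam - G) u⟩ u₀` with domain `D(G)`. -/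
noncomputable def rankOnePerturbation (G : X →ₗ.[ℝ] X) (lam : ℝ) (ell : X →L[ℝ] ℝ) (u₀ : X) :
    X →ₗ.[ℝ] X where
  domain := G.domain
  toFun := G.toFun + ((ell : X →ₗ[ℝ] ℝ) ∘ₗ (lam • G.domain.subtype - G.toFun)).smulRight u₀

theorem mem_graph_rankOnePerturbation {G : X →ₗ.[ℝ] X} {u₀ x y : X} :
    (x, y) ∈ (rankOnePerturbation G lam ell u₀).graph ↔
      x ∈ G.domain ∧ y = val G x + ell (lam • x - val G x) • u₀ := by
  rw [LinearPMap.mem_graph_iff]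
  constructor
  · rintro ⟨z, rfl, rfl⟩
    refine ⟨z.2, ?_⟩
    rw [val_eq_of_mem_graph (G.mem_graph z)]
    rfl
  · rintro ⟨hx, rfl⟩
    refine ⟨⟨x, hx⟩, rfl, ?_⟩
    rw [val_eq_of_mem_graph (G.mem_graph ⟨x, hx⟩)]
    rfl

namespace KatoConditions

theorem exists_isResolvent_rankOnePerturbation (hAB : KatoConditions A B) {V : C0Semigroup X}
    (hV : IsKatoSemigroup A B V) (hlam : 0 < lam) (hell : IsLossFunctional A B lam ell) {u₀ : X}
    (h0 : 0 ≤ u₀) (h1 : u₀ ≠ 0) (h2 : ‖u₀‖ ≤ 1) (hmu : 0 < mu) :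
    ∃ R : X →L[ℝ] X, IsResolvent (rankOnePerturbation V.generator lam ell u₀) mu R ∧
      ContractiveOnCone (mu • R) := by
  have hS := hV.isResolvent hAB hmu
  set S := katoResolvent A B mu
  set G := V.generator
  let F : X →L[ℝ] ℝ := ell ∘L (lam • S - (mu • S - 1))
  have hF : ∀ u, F u = ell (lam • S u - (mu • S u - u)) := fun u => rfl
  have hF0 : ∀ u : X, 0 ≤ u → 0 ≤ F u ∧ F u ≤ ‖u‖ - mu * ‖S u‖ := fun u hu =>
    hAB.loss_katoResolvent_mem hlam hell hmu hu
  -- Strictness comes from injectivity of S: F(u₀) ≤ ‖u₀‖ - μ‖S u₀‖ with S u₀ ≠ 0.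
  have hlt : F u₀ < 1 := by
    have hS0 : S u₀ ≠ 0 := fun h => by
      have h3 := LinearPMap.mem_graph_snd_inj _ (hS.mem_graph u₀) G.graph.zero_mem h
      change mu • S u₀ - u₀ = 0 at h3
      rw [h, smul_zero, zero_sub, neg_eq_zero] at h3
      exact h1 h3
    have := mul_pos hmu (norm_pos_iff.2 hS0)
    linarith [(hF0 u₀ h0).2]
  have hpos : 0 < 1 - F u₀ := sub_pos.2 hlt
  have hid : ∀ a : ℝ, (a / (1 - F u₀)) * (1 - F u₀) = a := fun a => div_mul_cancel₀ a hpos.ne'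
  -- The Sherman–Morrison formula: applying S to (μ - G)x = u + c u₀, where c = ell(λx - Gx), forces
  -- c = F(u) + c F(u₀).
  let R : X →L[ℝ] X := S + ((1 - F u₀)⁻¹ • F).smulRight (S u₀)
  have hR : ∀ u, R u = S (u + (F u / (1 - F u₀)) • u₀) := fun u => by
    rw [_root_.map_add, map_smul, div_eq_inv_mul]
    rfl
  have hval : ∀ u, ell (lam • R u - val G (R u)) = F u / (1 - F u₀) := fun u => by
    rw [hR, hS.val_apply, ← hF, _root_.map_add, map_smul, smul_eq_mul]
    linarith [hid (F u)]
  refine ⟨R, isResolvent_iff.2 ⟨fun u => mem_graph_rankOnePerturbation.2 ⟨?_, ?_⟩, ?_⟩, ?_⟩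
  · rw [hR]
    exact hS.mem_domain _
  · rw [hval, hR, hS.val_apply]
    abel
  · intro x y hxy
    obtain ⟨hx, rfl⟩ := mem_graph_rankOnePerturbation.1 hxy
    have h3 := hS.apply_graph (mk_val_mem_graph hx)
    set c := ell (lam • x - val G x) with hc
    set u := mu • x - (val G x + c • u₀) with hu
    have h4 : u + c • u₀ = mu • x - val G x := by rw [hu]; abel
    have h5 : F (u + c • u₀) = c := by
      rw [h4, hF, h3, hc]
      congr 1
      abel
    rw [_root_.map_add, map_smul, smul_eq_mul] at h5
    have h6 : F u / (1 - F u₀) = c := by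
      rw [div_eq_iff hpos.ne']
      linarith
    rw [hR, h6, h4, h3]
  · intro u hu
    have h3 : 0 ≤ F u / (1 - F u₀) := div_nonneg (hF0 u hu).1 hpos.le
    have h4 : R u = S u + (F u / (1 - F u₀)) • S u₀ := by rw [hR, _root_.map_add, map_smul]
    have h5 := hAB.katoResolvent_nonneg hmu hu
    have h6 := smul_nonneg h3 (hAB.katoResolvent_nonneg hmu h0)
    rw [_root_.smul_apply, h4]
    refine ⟨smul_nonneg hmu.le (add_nonneg h5 h6), ?_⟩
    rw [norm_smul, Real.norm_of_nonneg hmu.le, AbstractStateSpace.norm_add_of_nonneg _ _ h5 h6,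
      norm_smul, Real.norm_of_nonneg h3]
    -- Since μ‖S u₀‖ ≤ 1 - F(u₀), the rank-one term adds at most F(u), and F(u) + μ‖S u‖ ≤ ‖u‖.
    have h7 : F u / (1 - F u₀) * (mu * ‖S u₀‖) ≤ F u / (1 - F u₀) * (1 - F u₀) :=
      mul_le_mul_of_nonneg_left (by linarith [(hF0 u₀ h0).2]) h3
    rw [hid] at h7
    linarith [(hF0 u hu).2]

theorem exists_substochastic_rankOnePerturbation (hAB : KatoConditions A B) {V : C0Semigroup X}
    (hV : IsKatoSemigroup A B V) (hlam : 0 < lam) (hell : IsLossFunctional A B lam ell) {u₀ : X}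
    (h0 : 0 ≤ u₀) (h1 : u₀ ≠ 0) (h2 : ‖u₀‖ ≤ 1) : ∃ W : C0Semigroup X,
      W.IsSubstochastic ∧ W.generator = rankOnePerturbation V.generator lam ell u₀ := by
  have hex := fun mu (hmu : 0 < mu) =>
    hAB.exists_isResolvent_rankOnePerturbation (mu := mu) hV hlam hell h0 h1 h2 hmu
  let R : ℝ → X →L[ℝ] X := fun mu => resolventOp (rankOnePerturbation V.generator lam ell u₀) mu
  have hR : ∀ mu, 0 < mu → IsResolvent (rankOnePerturbation V.generator lam ell u₀) mu (R mu) ∧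
      ContractiveOnCone (mu • R mu) := fun mu hmu => by
    obtain ⟨S, hS, hS'⟩ := hex mu hmu
    have : R mu = S := hS.resolventOp_eq
    rw [this]
    exact ⟨hS, hS'⟩
  have hfam : SubstochasticResolvent R :=
    { contractive := fun mu hmu => (hR mu hmu).2
      identity := fun mu nu hmu hnu => (hR mu hmu).1.resolvent_identity (hR nu hnu).1
      tendsto := KatoHonesty.tendsto_smul_resolvent
        (G := rankOnePerturbation V.generator lam ell u₀) hV.substochastic.dense_domain
        (fun mu hmu => (hR mu hmu).1) fun mu hmu => (hR mu hmu).2 }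
  obtain ⟨W, hW, hWR⟩ := hfam.exists_semigroup
  exact ⟨W, hW, (hWR 1 one_pos).eq (hR 1 one_pos).1⟩

theorem exists_hasRankOneGenerator (hAB : KatoConditions A B) {V : C0Semigroup X}
    (hV : IsKatoSemigroup A B V) (hlam : 0 < lam) {u₀ : X}
    (h0 : 0 ≤ u₀) (h1 : u₀ ≠ 0) (h2 : ‖u₀‖ ≤ 1) :
    ∃ W ∈ substochasticExtensions A B, HasRankOneGenerator A B V.generator lam u₀ W := by
  obtain ⟨ell, hell⟩ := hAB.exists_isLossFunctional hlam
  obtain ⟨W, hW, hWG⟩ := hAB.exists_substochastic_rankOnePerturbation hV hlam hell h0 h1 h2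
  refine ⟨W, ⟨hW, hAB.add_le_iff.2 fun x hx => ?_⟩, by rw [hWG]; rfl, fun u hu => ?_⟩
  · have h3 := hAB.add_le_iff.1 hV.extends_add x hx
    rw [hWG, mem_graph_rankOnePerturbation]
    refine ⟨mem_domain_of_mem_graph h3, ?_⟩
    rw [val_eq_of_mem_graph h3, hAB.loss_apply_domain hlam hell hx, zero_smul, add_zero]
  · rw [hAB.aZero_sub_aBar hV hlam hell hu, hWG]
    exact val_eq_of_mem_graph (mem_graph_rankOnePerturbation.2 ⟨hu, rfl⟩)

theorem infinite_rankOne (hAB : KatoConditions A B) {V : C0Semigroup X}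
    (hV : IsKatoSemigroup A B V) (hlam : 0 < lam) (hdis : ¬ IsHonest A B V lam) :
    {W ∈ substochasticExtensions A B | ∃ u₀ : X, 0 ≤ u₀ ∧ u₀ ≠ 0 ∧ ‖u₀‖ ≤ 1 ∧
      HasRankOneGenerator A B V.generator lam u₀ W}.Infinite := by
  obtain ⟨ell, hell⟩ := hAB.exists_isLossFunctional hlam
  rw [hAB.isHonest_iff hV hlam hell] at hdis
  -- A trivial cone would make X trivial, hence `ell` zero.
  obtain ⟨e, he, he0⟩ : ∃ e : X, 0 ≤ e ∧ e ≠ 0 := by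
    by_contra! h
    refine hdis (ContinuousLinearMap.ext fun x => ?_)
    obtain ⟨u, v, hu, hv, rfl⟩ := AbstractStateSpace.generating x
    simp [h u hu, h v hv]
  have hn : 0 < ‖e‖ := norm_pos_iff.2 he0
  let c : ℕ → ℝ := fun n => ((n : ℝ) + 1)⁻¹ * ‖e‖⁻¹
  have hc : ∀ n, 0 < c n := fun n => by positivity
  have hc1 : ∀ n, ‖c n • e‖ ≤ 1 := fun n => by
    rw [norm_smul, Real.norm_of_nonneg (hc n).le, mul_assoc, inv_mul_cancel₀ hn.ne', mul_one]
    exact inv_le_one_of_one_le₀ (by linarith [n.cast_nonneg (α := ℝ)])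
  choose W hW hWG using fun n => hAB.exists_hasRankOneGenerator hV hlam
    (smul_nonneg (hc n).le he) (smul_ne_zero (hc n).ne' he0) (hc1 n)
  refine Set.infinite_of_injective_forall_mem (f := W) (fun m n hmn => ?_)
    fun n => ⟨hW n, _, smul_nonneg (hc n).le he, smul_ne_zero (hc n).ne' he0, hc1 n, hWG n⟩
  -- At x = S(λ)w the added term is ell(w) u₀, so the generator recovers the multiple of `e` and
  -- with it the index n.
  obtain ⟨w, hw⟩ : ∃ w, ell w ≠ 0 := by
    by_contra! h
    exact hdis (ContinuousLinearMap.ext h)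
  have hR := hV.isResolvent hAB hlam
  have hd := hR.mem_domain w
  have h1 := (hWG m).2 _ hd
  rw [hmn, (hWG n).2 _ hd, hAB.aZero_sub_aBar hV hlam hell hd, hR.val_apply, sub_sub_cancel,
    add_right_inj] at h1
  have h2 := smul_left_injective ℝ he0 (smul_right_injective X hw h1)
  have h3 := mul_right_cancel₀ (inv_ne_zero hn.ne') h2
  have h4 := inv_injective h3
  exact_mod_cast (add_right_cancel h4).symm

end KatoConditions

end KatoHonesty


theorem mainTheorem1 {X : Type*} [NormedAddCommGroup X] [NormedSpace ℝ X] [PartialOrder X]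
    [AbstractStateSpace X] (A B : X →ₗ.[ℝ] X) (hAB : KatoConditions A B) :
    (∃! V : C0Semigroup X, IsKatoSemigroup A B V) ∧
    ∀ V : C0Semigroup X, IsKatoSemigroup A B V → ∀ lam : ℝ, 0 < lam →
      (IsHonest A B V lam → substochasticExtensions A B = {V}) ∧
      (¬ IsHonest A B V lam →
        (substochasticExtensions A B).Infinite ∧
        (∀ u₀ : X, 0 ≤ u₀ → u₀ ≠ 0 → ‖u₀‖ ≤ 1 →
          ∃ W ∈ substochasticExtensions A B, HasRankOneGenerator A B V.generator lam u₀ W) ∧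
        {W ∈ substochasticExtensions A B | ∃ u₀ : X, 0 ≤ u₀ ∧ u₀ ≠ 0 ∧ ‖u₀‖ ≤ 1 ∧
          HasRankOneGenerator A B V.generator lam u₀ W}.Infinite) := by
  refine ⟨hAB.existsUnique_isKatoSemigroup, fun V hV lam hlam => ⟨fun h => ?_, fun h => ?_⟩⟩
  · obtain ⟨ell, hell⟩ := hAB.exists_isLossFunctional hlam
    obtain rfl := (hAB.isHonest_iff hV hlam hell).1 h
    refine Set.eq_singleton_iff_unique_mem.2 ⟨⟨hV.substochastic, hV.extends_add⟩, ?_⟩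
    rintro W ⟨hW, hext⟩
    exact hAB.eq_of_loss_eq_zero hV hlam hell hW hext
  · have hinf := hAB.infinite_rankOne hV hlam h
    exact ⟨hinf.mono fun W hW => hW.1,
      fun u₀ h0 h1 h2 => hAB.exists_hasRankOneGenerator hV hlam h0 h1 h2, hinf⟩
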